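/- Let $n\ge 5$ and $p\ge 2$ be integers, $C=2p(p-1)B\big(\tfrac{n-2}{2},\tfrac12\big)$ with $B$ the beta function, $T(v)=\int_v^1(1-u^2)^{(n-4)/2}\,du$, and for $J>0$ $$f_V(v;J)=\tfrac C2\,(1-v^2)^{(n-4)/2}\,J\,\exp\!\big(-\tfrac C2 J\,T(v)\big),\qquad v\in(0,1].$$ Since $\int_0^1 f_V(v;J)\,dv=1-e^{-\frac C2JT(0)}<1$, "$V\sim f_V(\cdot,J)$" is understood in one of the following two ways (the same for all $J$), and the theorem holds for each of them: (a) $V$ has density $f_V(\cdot;J)$ on $(0,1]$ and the remaining mass $e^{-\frac C2JT(0)}$ sits at $0$, i.e. $\mathsf P(V\le\rho)=e^{-\frac C2JT(\rho)}$ for $\rho\in[0,1]$; (b) $V$ has the density $f_V(\cdot;J)/\int_0^1f_V(u;J)\,du$ on $(0,1]$. Let $\bar J>1$, and let $\ell(v)$ be the log-likelihood ratio of the law with parameter $\bar J$ against the law with parameter $1$; in case (a), $\ell(v)=\log\frac{f_V(v;\bar J)}{f_V(v;1)}$ for $v\in(0,1)$ and $\ell(0)=-\frac C2(\bar J-1)T(0)$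 is the logarithm of the ratio of the masses at $0$. Observations $V_1,V_2,\dots$ are independent, with $V_m\sim f_V(\cdot,1)$ for $m<\nu$ and $V_m\sim f_V(\cdot,J_m)$ for $m\ge\nu$, where $\nu\ge1$ is an unknown change point and $G=(J_m)_{m\ge1}$ is an unknown sequence with $J_m\ge\bar J$ for all $m$; $\mathsf E_\nu^G$ denotes the expectation in this model and $\mathsf E_\infty$, $\mathsf P_\infty$ refer to the model without a change. For a stopping time $\tau\in\{1,2,\dots\}\cup\{\infty\}$ of the observations put $$\mathrm{WADD}^G(\tau)=\sup_{\nu\ge1}\operatorname{ess\,sup}\mathsf E^G_\nu\big[(\tau-\nu+1)^+\mid V_1,\dots,V_{\nu-1}\big],\qquad \mathrm{MFA}(\tau)=\mathsf E_\infty[\tau].$$ For $A\in\mathbb R$ let $W_0=0$, $W_m=\max\{0,W_{m-1}+\ell(V_m)\}$ and $\tau_A=\min\{m\ge1:W_m\ge A\}$ (the CUSUM test built with $\bar J$). Then: 1. (Least favorable law.) $f_V(\cdot,\bar J)$ is the least favorable law for the family $\{f_V(\cdot,J):J\ge\bar J\}$: it belongs to the family, and for every $J\ge\bar J$ and $t\in\mathbb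 R$, the probability of $\{\ell(V)\ge t\}$ under $V\sim f_V(\cdot,J)$ is at least its probability under $V\sim f_V(\cdot,\bar J)$. 2. (Exact robust optimality.) For every $\beta>0$ and every threshold $A$ with $\mathrm{MFA}(\tau_A)=\beta$, the test $\tau_A$ minimises $\sup_G\mathrm{WADD}^G(\tau)$ among all stopping times $\tau\ge1$ with $\mathrm{MFA}(\tau)\ge\beta$. Such a threshold exists for every $\beta>1/\mathsf P_\infty(\ell(V_1)>0)$. For $0<\beta\le1$ some $\tau_A$ with $\mathrm{MFA}(\tau_A)=1$ minimises $\sup_G\mathrm{WADD}^G(\tau)$ among all stopping times $\tau\ge1$ with $\mathrm{MFA}(\tau)\ge\beta$. Part 2 holds both when the supremum is over all sequences $J_m\ge\bar J$ and when the post-change parameters may also depend on the change point, i.e. over all arrays $J_{m,\nu}\ge\bar J$. -/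

import Mathlib

open MeasureTheory Set
open scoped ENNReal

noncomputable section

/-! ## Robust quickest change detection for independent real observations

Densities are taken with respect to a reference measure `ref` on `ℝ`.  A path `x : ℕ → ℝ` lists the
observations in order: `x k` is the observation made at time `k + 1`. -/

namespace RobustQCD

/-- The law with density `f` with respect to `ref`. -/
def law (ref : Measure ℝ) (f : ℝ → ℝ) : Measure ℝ :=
  ref.withDensity fun v => ENNReal.ofReal (f v)

/-- The log-likelihood ratio `log (f₁ v / f₀ v)`. -/
def llr (f₁ f₀ : ℝ → ℝ) (v : ℝ) : ℝ := Real.log (f₁ v / f₀ v)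

/-- `P₂ ≻ P₁`: the law `P₂` is stochastically larger than the law `P₁`. -/
def StochLarger (P₂ P₁ : Measure ℝ) : Prop := ∀ t : ℝ, P₁ (Ici t) ≤ P₂ (Ici t)

/-- `fbar` is the least favorable law for the family `P m ν` (`m` is the time of the observation,
`ν` the change point) with pre-change density `f₀`. -/
def IsLFL (ref : Measure ℝ) (f₀ : ℝ → ℝ) (P : ℕ → ℕ → Set (ℝ → ℝ)) (fbar : ℕ → ℕ → ℝ → ℝ) : Prop :=
  (∀ m ν : ℕ, 1 ≤ m → 1 ≤ ν → fbar m ν ∈ P m ν) ∧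
  ∀ m ν : ℕ, 1 ≤ m → 1 ≤ ν → ∀ f ∈ P m ν,
    StochLarger ((law ref f).map (llr (fbar m ν) f₀)) ((law ref (fbar m ν)).map (llr (fbar m ν) f₀))

/-- All post-change density sequences `G = {f_{m,ν}}` with `f_{m,ν} ∈ P m ν`. -/
def sequencesIn (P : ℕ → ℕ → Set (ℝ → ℝ)) : Set (ℕ → ℕ → ℝ → ℝ) :=
  {G | ∀ m ν : ℕ, 1 ≤ m → 1 ≤ ν → G m ν ∈ P m ν}

/-- The law `P_∞` of the observations when no change ever occurs. -/
def noChangeLaw (ref : Measure ℝ) (f₀ : ℝ → ℝ) : Measure (ℕ → ℝ) :=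
  Measure.infinitePi fun _ => law ref f₀

/-- The law `P_ν` of the observations when the change occurs at time `ν`: they are independent,
with density `f₀` at the times `m < ν` and density `G m ν` at the times `m ≥ ν`. -/
def changeLaw (ref : Measure ℝ) (f₀ : ℝ → ℝ) (G : ℕ → ℕ → ℝ → ℝ) (ν : ℕ) : Measure (ℕ → ℝ) :=
  Measure.infinitePi fun k => law ref (if k + 1 < ν then f₀ else G (k + 1) ν)

/-- The observation filtration: `obsFiltration m` is generated by the observations made at the
times `1, …, m`. -/
def obsFiltration : Filtration ℕ (MeasurableSpace.pi : MeasurableSpace (ℕ → ℝ)) where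
  seq m := MeasurableSpace.comap (fun (x : ℕ → ℝ) (i : Fin m) => x i) MeasurableSpace.pi
  mono' := by
    intro a b hab
    have h : Measurable fun (y : Fin b → ℝ) (i : Fin a) => y (Fin.castLE hab i) := by fun_prop
    rintro s ⟨t, ht, rfl⟩
    exact ⟨_, h ht, rfl⟩
  le' := by
    intro m
    have h : Measurable fun (x : ℕ → ℝ) (i : Fin m) => x i := by fun_prop
    exact h.comap_le

/-- The mean time to a false alarm, `E_∞[τ]`; the value `τ = ⊤` means that no alarm is raised. -/
def MFA (ref : Measure ℝ) (f₀ : ℝ → ℝ) (τ : (ℕ → ℝ) → ℕ∞) : ℝ≥0∞ :=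
  ∫⁻ x, (τ x : ℝ≥0∞) ∂(noChangeLaw ref f₀)

/-- The delay `(τ - ν + 1)⁺`, with values in `[0, ∞]` (where subtraction is truncated at `0`). -/
def delay (τ : (ℕ → ℝ) → ℕ∞) (ν : ℕ) (x : ℕ → ℝ) : ℝ≥0∞ := ((τ x : ℝ≥0∞) + 1) - (ν : ℝ≥0∞)

/-- Lorden's worst-case average detection delay: the supremum over `ν ≥ 1` of the essential supremum
of `E_ν[(τ - ν + 1)⁺ | observations at the times 1, …, ν - 1]`. -/
def WADD (ref : Measure ℝ) (f₀ : ℝ → ℝ) (G : ℕ → ℕ → ℝ → ℝ) (τ : (ℕ → ℝ) → ℕ∞) : ℝ≥0∞ :=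
  ⨆ (ν : ℕ) (_ : 1 ≤ ν),
    essSup (condLExp (obsFiltration (ν - 1)) (changeLaw ref f₀ G ν) (delay τ ν))
      (changeLaw ref f₀ G ν)

/-- The stopping times `τ ≥ 1` that satisfy the false alarm constraint `MFA(τ) ≥ β`. -/
def IsAdmissible (ref : Measure ℝ) (f₀ : ℝ → ℝ) (β : ℝ) (τ : (ℕ → ℝ) → ℕ∞) : Prop :=
  IsStoppingTime obsFiltration τ ∧ (∀ x, 1 ≤ τ x) ∧ ENNReal.ofReal β ≤ MFA ref f₀ τ

/-- `τ` minimises `sup_{G ∈ 𝒢} WADD^G` subject to `MFA ≥ β`. -/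
def IsRobustOptimal (ref : Measure ℝ) (f₀ : ℝ → ℝ) (𝒢 : Set (ℕ → ℕ → ℝ → ℝ)) (β : ℝ)
    (τ : (ℕ → ℝ) → ℕ∞) : Prop :=
  IsAdmissible ref f₀ β τ ∧
  ∀ σ : (ℕ → ℝ) → ℕ∞, IsAdmissible ref f₀ β σ →
    ⨆ G ∈ 𝒢, WADD ref f₀ G τ ≤ ⨆ G ∈ 𝒢, WADD ref f₀ G σ

/-- The CUSUM statistic: `W_0 = 0`, `W_m = max {0, W_{m-1} + log (f₁ / f₀) (observation m)}`. -/
def cusum (f₁ f₀ : ℝ → ℝ) (x : ℕ → ℝ) : ℕ → ℝ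
  | 0 => 0
  | m + 1 => max 0 (cusum f₁ f₀ x m + llr f₁ f₀ (x m))

/-- The CUSUM test `min {m ≥ 1 : W_m ≥ A}` with threshold `A` (equal to `⊤` if there is no such
`m`). -/
def cusumTime (f₁ f₀ : ℝ → ℝ) (A : ℝ) (x : ℕ → ℝ) : ℕ∞ :=
  ⨅ (m : ℕ) (_ : 1 ≤ m ∧ A ≤ cusum f₁ f₀ x m), (m : ℕ∞)

end RobustQCD

/-! ## The maximum magnitude correlation model -/

namespace MaxCorrelation

open RobustQCD

/-- `C = 2 p (p - 1) B((n - 2) / 2, 1 / 2)`. -/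
def C (n p : ℕ) : ℝ :=
  2 * (p : ℝ) * ((p : ℝ) - 1) * ProbabilityTheory.beta (((n : ℝ) - 2) / 2) (1 / 2)

/-- `T(v) = ∫_v^1 (1 - u²)^{(n - 4) / 2} du`. -/
def T (n : ℕ) (v : ℝ) : ℝ := ∫ u in v..1, (1 - u ^ 2) ^ (((n : ℝ) - 4) / 2)

/-- `f_V(v; J) = (C / 2) (1 - v²)^{(n - 4) / 2} J exp (-(C / 2) J T(v))` for `v ∈ (0, 1]`, and `0`
elsewhere. -/
def fV (n p : ℕ) (J v : ℝ) : ℝ :=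
  if v ∈ Ioc (0 : ℝ) 1 then
    C n p / 2 * (1 - v ^ 2) ^ (((n : ℝ) - 4) / 2) * J * Real.exp (-(C n p / 2) * J * T n v)
  else 0

/-- The integral of `f_V(·; J)` over `(0, 1]` is `1 - exp (-(C / 2) J T(0)) < 1`.  The two ways to
turn `f_V(·; J)` into a probability law: give the missing mass to the point `0`, which is the law
with distribution function `P(V ≤ v) = exp (-(C / 2) J T(v))` for `v ∈ [0, 1]`, or divide `f_V(·; J)`
by its integral. -/
inductive Completion
  | atomAtZero
  | normalized

/-- The reference measure for the densities. -/
def refMeasure : Completion → Measure ℝ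
  | .atomAtZero => volume + Measure.dirac 0
  | .normalized => volume

/-- The density of `V` with parameter `J`, with respect to the reference measure. -/
def density : Completion → (n p : ℕ) → (J v : ℝ) → ℝ
  | .atomAtZero, n, p, J, v => if v = 0 then Real.exp (-(C n p / 2) * J * T n 0) else fV n p J v
  | .normalized, n, p, J, v => fV n p J v / ∫ u in Ioc (0 : ℝ) 1, fV n p J u

/-- The uncertainty class: at all times and for all change points, the densities with a parameter
`J ≥ Jbar`. -/
def uncertaintyClass (κ : Completion) (n p : ℕ) (Jbar : ℝ) (_m _ν : ℕ) : Set (ℝ → ℝ) :=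
  {f | ∃ J : ℝ, Jbar ≤ J ∧ f = density κ n p J}

/-- The post-change density sequences of the model `V_m ∼ f_V(·, J_m)` for `m ≥ ν`, with an unknown
sequence `J_m ≥ Jbar` that does not depend on the change point. -/
def timeVaryingSequences (κ : Completion) (n p : ℕ) (Jbar : ℝ) : Set (ℕ → ℕ → ℝ → ℝ) :=
  {G | ∃ J : ℕ → ℝ, (∀ m, 1 ≤ m → Jbar ≤ J m) ∧ G = fun m _ => density κ n p (J m)}

/-! ### The densities are probability densities -/

lemma C_pos {n p : ℕ} (hn : 5 ≤ n) (hp : 2 ≤ p) : 0 < C n p := by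
  have hn' : (5 : ℝ) ≤ n := by exact_mod_cast hn
  have hp' : (2 : ℝ) ≤ p := by exact_mod_cast hp
  have hB : 0 < ProbabilityTheory.beta (((n : ℝ) - 2) / 2) (1 / 2) :=
    ProbabilityTheory.beta_pos (by linarith) (by norm_num)
  have h1 : (0 : ℝ) < (p : ℝ) - 1 := by linarith
  have h2 : (0 : ℝ) < p := by linarith
  unfold C
  positivity

lemma continuous_integrand {n : ℕ} (hn : 5 ≤ n) :
    Continuous fun u : ℝ => (1 - u ^ 2) ^ (((n : ℝ) - 4) / 2) := by
  have hn' : (5 : ℝ) ≤ n := by exact_mod_cast hn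
  exact Continuous.rpow_const (by fun_prop) fun x => Or.inr (by linarith)

lemma hasDerivAt_T {n : ℕ} (hn : 5 ≤ n) (v : ℝ) :
    HasDerivAt (T n) (-(1 - v ^ 2) ^ (((n : ℝ) - 4) / 2)) v := by
  have hc := continuous_integrand hn
  exact intervalIntegral.integral_hasDerivAt_left (hc.intervalIntegrable _ _)
    hc.aestronglyMeasurable.stronglyMeasurableAtFilter hc.continuousAt

lemma continuous_T {n : ℕ} (hn : 5 ≤ n) : Continuous (T n) :=
  continuous_iff_continuousAt.2 fun v => (hasDerivAt_T hn v).continuousAt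

/-- The formula for `f_V`, without the restriction to `(0, 1]`. -/
lemma continuous_formula {n : ℕ} (p : ℕ) (hn : 5 ≤ n) (J : ℝ) :
    Continuous fun v : ℝ => C n p / 2 * (1 - v ^ 2) ^ (((n : ℝ) - 4) / 2) * J *
      Real.exp (-(C n p / 2) * J * T n v) := by
  have h1 := continuous_integrand hn
  have h2 := continuous_T hn
  fun_prop

lemma measurable_fV {n : ℕ} (p : ℕ) (hn : 5 ≤ n) (J : ℝ) : Measurable (fV n p J) :=
  Measurable.ite measurableSet_Ioc (continuous_formula p hn J).measurable measurable_const

lemma fV_nonneg {n p : ℕ} (hn : 5 ≤ n) (hp : 2 ≤ p) {J : ℝ} (hJ : 0 < J) (v : ℝ) :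
    0 ≤ fV n p J v := by
  unfold fV
  split_ifs with h
  · have hC := C_pos hn hp
    have h1 : (0 : ℝ) ≤ 1 - v ^ 2 := by nlinarith [h.1, h.2]
    have h2 := Real.rpow_nonneg h1 (((n : ℝ) - 4) / 2)
    positivity
  · exact le_rfl

lemma integrableOn_fV {n : ℕ} (p : ℕ) (hn : 5 ≤ n) (J : ℝ) :
    IntegrableOn (fV n p J) (Ioc 0 1) := by
  have h : IntegrableOn (fun v : ℝ => C n p / 2 * (1 - v ^ 2) ^ (((n : ℝ) - 4) / 2) * J *
      Real.exp (-(C n p / 2) * J * T n v)) (Ioc 0 1) :=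
    ((continuous_formula p hn J).continuousOn.integrableOn_Icc (a := 0) (b := 1)).mono_set
      Ioc_subset_Icc_self
  refine h.congr_fun (fun v hv => ?_) measurableSet_Ioc
  simp only [fV, if_pos hv]

lemma integral_fV {n : ℕ} (p : ℕ) (hn : 5 ≤ n) (J : ℝ) :
    ∫ v in Ioc (0 : ℝ) 1, fV n p J v = 1 - Real.exp (-(C n p / 2) * J * T n 0) := by
  have hd : ∀ v : ℝ, HasDerivAt (fun v => Real.exp (-(C n p / 2) * J * T n v))
      (C n p / 2 * (1 - v ^ 2) ^ (((n : ℝ) - 4) / 2) * J *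
        Real.exp (-(C n p / 2) * J * T n v)) v := by
    intro v
    convert ((hasDerivAt_T hn v).const_mul (-(C n p / 2) * J)).exp using 1
    ring
  have h := intervalIntegral.integral_eq_sub_of_hasDerivAt (a := 0) (b := 1)
    (fun v _ => hd v) ((continuous_formula p hn J).intervalIntegrable _ _)
  have hT : T n 1 = 0 := by simp [T]
  rw [hT, mul_zero, Real.exp_zero, intervalIntegral.integral_of_le zero_le_one] at h
  rw [← h]
  refine setIntegral_congr_fun measurableSet_Ioc fun v hv => ?_
  simp only [fV, if_pos hv]

lemma T_zero_pos {n : ℕ} (hn : 5 ≤ n) : 0 < T n 0 := by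
  refine intervalIntegral.intervalIntegral_pos_of_pos_on
    ((continuous_integrand hn).intervalIntegrable _ _) (fun u hu => ?_) zero_lt_one
  exact Real.rpow_pos_of_pos (by nlinarith [hu.1, hu.2]) _

lemma integral_fV_pos {n p : ℕ} (hn : 5 ≤ n) (hp : 2 ≤ p) {J : ℝ} (hJ : 0 < J) :
    0 < ∫ v in Ioc (0 : ℝ) 1, fV n p J v := by
  rw [integral_fV p hn J, sub_pos, Real.exp_lt_one_iff]
  have h1 := C_pos hn hp
  have h2 := T_zero_pos hn
  have h3 : 0 < C n p / 2 * J * T n 0 := by positivity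
  linarith

lemma lintegral_fV {n p : ℕ} (hn : 5 ≤ n) (hp : 2 ≤ p) {J : ℝ} (hJ : 0 < J) :
    ∫⁻ v, ENNReal.ofReal (fV n p J v) = ENNReal.ofReal (∫ v in Ioc (0 : ℝ) 1, fV n p J v) := by
  rw [ofReal_integral_eq_lintegral_ofReal (integrableOn_fV p hn J)
    (Filter.Eventually.of_forall fun v => fV_nonneg hn hp hJ v)]
  rw [← lintegral_indicator measurableSet_Ioc]
  congr 1
  funext v
  by_cases hv : v ∈ Ioc (0 : ℝ) 1
  · rw [indicator_of_mem hv]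
  · rw [indicator_of_notMem hv]
    simp only [fV, if_neg hv, ENNReal.ofReal_zero]

lemma measurable_density (κ : Completion) {n : ℕ} (p : ℕ) (hn : 5 ≤ n) (J : ℝ) :
    Measurable (density κ n p J) := by
  cases κ with
  | atomAtZero =>
    exact Measurable.ite (measurableSet_singleton (0 : ℝ)) measurable_const (measurable_fV p hn J)
  | normalized => exact (measurable_fV p hn J).div_const _

/-- For every `J > 0`, the law with density `density κ n p J` is a probability measure. -/
lemma isProbabilityMeasure_law (κ : Completion) {n p : ℕ} (hn : 5 ≤ n) (hp : 2 ≤ p) {J : ℝ}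
    (hJ : 0 < J) : IsProbabilityMeasure (law (refMeasure κ) (density κ n p J)) := by
  constructor
  rw [law, withDensity_apply _ MeasurableSet.univ, Measure.restrict_univ]
  have hI := integral_fV p hn J
  have hpos := integral_fV_pos hn hp hJ
  cases κ with
  | atomAtZero =>
    have h0 : ∫⁻ v, ENNReal.ofReal (density .atomAtZero n p J v) =
        ∫⁻ v, ENNReal.ofReal (fV n p J v) := by
      refine lintegral_congr_ae ?_
      have : ∀ᵐ v : ℝ, v ≠ 0 := by simp [ae_iff]
      filter_upwards [this] with v hv
      simp only [density, if_neg hv]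
    simp only [refMeasure]
    rw [lintegral_add_measure, h0, lintegral_fV hn hp hJ, lintegral_dirac]
    simp only [density, if_true]
    rw [← ENNReal.ofReal_add hpos.le (Real.exp_pos _).le, hI]
    simp
  | normalized =>
    simp only [refMeasure, density]
    have h1 : ∀ v, ENNReal.ofReal (fV n p J v / ∫ u in Ioc (0 : ℝ) 1, fV n p J u) =
        ENNReal.ofReal (fV n p J v) * (ENNReal.ofReal (∫ u in Ioc (0 : ℝ) 1, fV n p J u))⁻¹ := by
      intro v
      rw [ENNReal.ofReal_div_of_pos hpos, div_eq_mul_inv]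
    simp_rw [h1]
    rw [lintegral_mul_const _ (measurable_fV p hn J).ennreal_ofReal, lintegral_fV hn hp hJ]
    exact ENNReal.mul_inv_cancel (by simpa using hpos) ENNReal.ofReal_ne_top

end MaxCorrelation

end

open RobustQCD MaxCorrelation

/-! The argument is a saddle point built on Moustakides' proof that CUSUM is exactly optimal for
Lorden's criterion. Let f₀ and f₁ be the densities with parameters 1 and `Jbar`, let ℓ = log (f₁ /
f₀), and let N and D be the mean run lengths of the CUSUM test from W_0 = 0 under f₀ and f₁. The
constant sequence f₁ belongs to the uncertainty class. For a threshold A > 0 it therefore suffices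
that every admissible G gives the CUSUM test a worst-case delay of at most D, and that every σ with
MFA(σ) ≥ N has a worst-case delay of at least D under f₁.

Upper bound (`WADD_cusumTime_le`): the CUSUM recursion is increasing in its starting value and in
its increments. Every admissible post-change law makes ℓ stochastically larger than f₁ does, so the
worst case is a start at 0 with law f₁. The stochastic order comes from the monotone likelihood
ratio `density_mul_density_lt`, which also makes ℓ increasing on the support.

Lower bound (`runLength_le_WADD`): put g_0 = 1 and g_m = (1 - exp (W_{m-1} + ℓ(V_m)))⁺. Then exp W_m
is a sum of likelihood ratios over the possible change points, with weights g. Averaging the delay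
of σ with these weights gives E_∞ ∑_{m<σ} exp W_m ≤ WADD(σ) E_∞ ∑_{m<σ} g_m. A Lagrangian stopping
problem, with a potential from `exists_potential`, gives D E_∞ ∑_{m<σ} g_m + λ MFA(σ) ≤ E_∞ ∑_{m<σ}
exp W_m + λ N. Since MFA(σ) ≥ N and the sum of the g_m is at least 1, WADD(σ) < D is impossible.

Thresholds (`exists_MFA_cusumTime_eq`): the mean time to a false alarm is monotone and
left-continuous in A. It is right-continuous at A > 0 because ℓ has at most one atom, which is
negative, so W_m has no positive atom. -/

namespace RobustQCD

/-! ### Product measures on path space, the observation filtration and Lorden's delay -/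

section PathSpace

/-- Resampling one coordinate of a product measure does not change it. -/
lemma lintegral_infinitePi_update (μ : ℕ → Measure ℝ) [∀ i, IsProbabilityMeasure (μ i)] (m : ℕ)
    {f : (ℕ → ℝ) → ℝ≥0∞} (hf : Measurable f) :
    ∫⁻ x, f x ∂Measure.infinitePi μ =
      ∫⁻ x, ∫⁻ v, f (Function.update x m v) ∂μ m ∂Measure.infinitePi μ := by
  have hu : Measurable fun q : (ℕ → ℝ) × ℝ => Function.update q.1 m q.2 :=
    measurable_update' (X := fun _ : ℕ => ℝ)
  -- It suffices to compare finite boxes; the resampled coordinate supplies its own factor exactly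
  -- when `m ∈ s`.
  have key : ((Measure.infinitePi μ).prod (μ m)).map
      (fun q : (ℕ → ℝ) × ℝ => Function.update q.1 m q.2) = Measure.infinitePi μ := by
    refine Measure.eq_infinitePi μ fun s t ht => ?_
    rw [Measure.map_apply hu (MeasurableSet.pi s.countable_toSet fun i _ => ht i)]
    by_cases hm : m ∈ s
    · have : (fun q : (ℕ → ℝ) × ℝ => Function.update q.1 m q.2) ⁻¹' (Set.pi s t) =
          (Set.pi (s.erase m : Finset ℕ) t) ×ˢ t m := by
        ext q
        simp only [mem_preimage, Set.mem_pi, Finset.mem_coe, Finset.mem_erase, mem_prod]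
        constructor
        · intro h
          refine ⟨fun i hi => ?_, ?_⟩
          · simpa [Function.update_of_ne hi.1] using h i hi.2
          · simpa using h m hm
        · rintro ⟨h1, h2⟩ i hi
          by_cases him : i = m
          · subst him; simpa using h2
          · simpa [Function.update_of_ne him] using h1 i ⟨him, hi⟩
      rw [this, Measure.prod_prod, Measure.infinitePi_pi _ fun i _ => ht i,
        Finset.prod_erase_mul _ _ hm]
    · have : (fun q : (ℕ → ℝ) × ℝ => Function.update q.1 m q.2) ⁻¹' (Set.pi s t) =
          (Set.pi s t) ×ˢ univ := by
        ext q
        simp only [mem_preimage, Set.mem_pi, Finset.mem_coe, mem_prod, mem_univ, and_true]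
        refine forall₂_congr fun i hi => ?_
        rw [Function.update_of_ne (by rintro rfl; exact hm hi)]
      rw [this, Measure.prod_prod, Measure.infinitePi_pi _ fun i _ => ht i, measure_univ, mul_one]
  conv_lhs => rw [← key]
  rw [lintegral_map hf hu]
  exact lintegral_prod _ (hf.comp hu).aemeasurable

lemma measurable_lintegral_update (μ : Measure ℝ) [SFinite μ] (m : ℕ) {f : (ℕ → ℝ) → ℝ≥0∞}
    (hf : Measurable f) : Measurable fun x => ∫⁻ v, f (Function.update x m v) ∂μ := by
  have hu : Measurable fun q : (ℕ → ℝ) × ℝ => Function.update q.1 m q.2 :=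
    measurable_update' (X := fun _ : ℕ => ℝ)
  exact (hf.comp hu).lintegral_prod_right'

lemma dependsOn_lintegral_update (μ : Measure ℝ) (m : ℕ) {f : (ℕ → ℝ) → ℝ≥0∞}
    (hf : DependsOn f (Iio (m + 1))) :
    DependsOn (fun x => ∫⁻ v, f (Function.update x m v) ∂μ) (Iio m) := by
  intro x y hxy
  refine lintegral_congr fun v => hf fun i hi => ?_
  by_cases him : i = m
  · subst him; simp
  · rw [Function.update_of_ne him, Function.update_of_ne him]
    exact hxy i (by simp only [mem_Iio] at hi ⊢; omega)

/-- Product measures that agree on the first `m` coordinates give the same integral to functions of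
these coordinates. -/
lemma lintegral_infinitePi_congr {μ ν : ℕ → Measure ℝ} [∀ i, IsProbabilityMeasure (μ i)]
    [∀ i, IsProbabilityMeasure (ν i)] {m : ℕ} (h : ∀ i < m, μ i = ν i) {f : (ℕ → ℝ) → ℝ≥0∞}
    (hf : Measurable f) (hd : DependsOn f (Iio m)) :
    ∫⁻ x, f x ∂Measure.infinitePi μ = ∫⁻ x, f x ∂Measure.infinitePi ν := by
  induction m generalizing f with
  | zero =>
    have hc : f = fun _ => f 0 := funext fun x => hd fun i hi => absurd hi (by simp)
    rw [hc]; simp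
  | succ m ih =>
    rw [lintegral_infinitePi_update μ m hf, lintegral_infinitePi_update ν m hf, h m (by omega)]
    exact ih (fun i hi => h i (by omega)) (measurable_lintegral_update _ m hf)
      (dependsOn_lintegral_update _ m hd)

/-- Level sets are cylinders over the first `m` coordinates, which gives the dependence. Conversely,
such a function factors through the restriction to these coordinates. -/
lemma measurable_obsFiltration_iff {β : Type*} [MeasurableSpace β] [MeasurableSingletonClass β]
    {m : ℕ} {f : (ℕ → ℝ) → β} :
    Measurable[obsFiltration m] f ↔ Measurable f ∧ DependsOn f (Iio m) := by
  constructor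
  · intro h
    refine ⟨h.mono (obsFiltration.le m) le_rfl, fun x y hxy => ?_⟩
    obtain ⟨t, -, ht⟩ := h (measurableSet_singleton (f x))
    have hx : x ∈ f ⁻¹' {f x} := rfl
    have hy : y ∈ f ⁻¹' {f x} := by
      rw [← ht] at hx ⊢
      have : (fun i : Fin m => y i) = fun i : Fin m => x i :=
        funext fun i => (hxy i i.2).symm
      simpa only [mem_preimage, this] using hx
    exact (show f y = f x from hy).symm
  · rintro ⟨h, hd⟩
    -- A finite path is padded with zeros; by `hd` the padding does not affect `f`.
    have he : Measurable fun (y : Fin m → ℝ) (i : ℕ) => if hi : i < m then y ⟨i, hi⟩ else 0 := by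
      refine measurable_pi_iff.2 fun i => ?_
      by_cases hi : i < m
      · simpa [hi] using measurable_pi_apply _
      · simp [hi]
    have hf : f = (fun y : Fin m → ℝ => f fun i => if hi : i < m then y ⟨i, hi⟩ else 0) ∘
        fun (x : ℕ → ℝ) (i : Fin m) => x i := by
      funext x
      refine hd fun i hi => ?_
      have : i < m := hi
      simp [this]
    rw [hf]
    exact (h.comp he).comp (comap_measurable _)

lemma measurableSet_obsFiltration_iff {m : ℕ} {s : Set (ℕ → ℝ)} :
    MeasurableSet[obsFiltration m] s ↔ MeasurableSet s ∧ DependsOn (· ∈ s) (Iio m) := by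
  have h := measurable_obsFiltration_iff (m := m) (f := fun x => x ∈ s)
  have h1 : (Measurable[obsFiltration m] fun x => x ∈ s) ↔ MeasurableSet[obsFiltration m] s :=
    @measurable_mem _ s (obsFiltration m)
  rwa [h1, measurable_mem] at h

lemma tsum_ite_lt (e : ℕ∞) (j : ℕ) :
    ∑' k : ℕ, (if ((j + k : ℕ) : ℕ∞) < e then (1 : ℝ≥0∞) else 0) = (e : ℝ≥0∞) - j := by
  induction e using ENat.recTopCoe with
  | top => simp [-Nat.cast_add]
  | coe n =>
    simp only [Nat.cast_lt, ENat.toENNReal_coe]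
    rw [tsum_eq_sum (s := Finset.range (n - j))]
    · rw [Finset.sum_congr rfl (g := fun _ => (1 : ℝ≥0∞))]
      · simp
      · intro k hk
        rw [Finset.mem_range] at hk
        rw [if_pos (by omega)]
    · intro k hk
      rw [Finset.mem_range] at hk
      rw [if_neg (by omega)]

/-- The delay counts the times at which the test is still running. Each summand is decided by the
first `j + k` observations, so delays turn into sums of survival probabilities. -/
lemma delay_succ (τ : (ℕ → ℝ) → ℕ∞) (j : ℕ) (x : ℕ → ℝ) :
    delay τ (j + 1) x = ∑' k : ℕ, (if ((j + k : ℕ) : ℕ∞) < τ x then (1 : ℝ≥0∞) else 0) := by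
  rw [tsum_ite_lt, delay]
  push_cast
  exact ENNReal.add_sub_add_eq_sub_right ENNReal.one_ne_top

lemma MFA_eq_tsum (ref : Measure ℝ) (f₀ : ℝ → ℝ) (τ : (ℕ → ℝ) → ℕ∞)
    (hτ : ∀ k : ℕ, MeasurableSet {x | (k : ℕ∞) < τ x}) :
    MFA ref f₀ τ = ∑' k : ℕ, noChangeLaw ref f₀ {x | (k : ℕ∞) < τ x} := by
  have h : ∀ x, (τ x : ℝ≥0∞) = ∑' k : ℕ, (if (k : ℕ∞) < τ x then (1 : ℝ≥0∞) else 0) := by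
    intro x
    have := tsum_ite_lt (τ x) 0
    simpa using this.symm
  simp_rw [MFA, h]
  rw [lintegral_tsum]
  · refine tsum_congr fun k => ?_
    rw [← lintegral_indicator_one (hτ k)]
    exact lintegral_congr fun x => by simp [indicator_apply]
  · exact fun k => (Measurable.ite (hτ k) measurable_const measurable_const).aemeasurable

lemma measurableSet_lt_stoppingTime {τ : (ℕ → ℝ) → ℕ∞} (hτ : IsStoppingTime obsFiltration τ)
    (k : ℕ) : MeasurableSet[obsFiltration k] {x | (k : ℕ∞) < τ x} := by
  have h := (hτ k).compl
  convert h using 1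
  ext x
  exact (not_le (a := τ x) (b := (k : ℕ∞))).symm

lemma measurable_ite_lt {τ : (ℕ → ℝ) → ℕ∞} (hτ : IsStoppingTime obsFiltration τ) (k : ℕ) :
    Measurable fun x => if (k : ℕ∞) < τ x then (1 : ℝ≥0∞) else 0 :=
  Measurable.ite (obsFiltration.le k _ (measurableSet_lt_stoppingTime hτ k))
    measurable_const measurable_const

lemma dependsOn_ite_lt {τ : (ℕ → ℝ) → ℕ∞} (hτ : IsStoppingTime obsFiltration τ) (k : ℕ) :
    DependsOn (fun x => if (k : ℕ∞) < τ x then (1 : ℝ≥0∞) else 0) (Iio k) := by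
  intro x y hxy
  have := (measurableSet_obsFiltration_iff.1 (measurableSet_lt_stoppingTime hτ k)).2 hxy
  have h : ((k : ℕ∞) < τ x) = ((k : ℕ∞) < τ y) := this
  simp only [h]

lemma measurable_delay {τ : (ℕ → ℝ) → ℕ∞} (hτ : IsStoppingTime obsFiltration τ) (j : ℕ) :
    Measurable (delay τ (j + 1)) := by
  have : delay τ (j + 1) =
      fun x => ∑' k : ℕ, (if ((j + k : ℕ) : ℕ∞) < τ x then (1 : ℝ≥0∞) else 0) :=
    funext (delay_succ τ j)
  rw [this]
  exact Measurable.tsum fun k => measurable_ite_lt hτ (j + k)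

/-- A conditional expectation is determined by its integrals over events of the past, so a bound on
these integrals replaces the essential supremum. -/
lemma WADD_le (ref : Measure ℝ) (f₀ : ℝ → ℝ) (G : ℕ → ℕ → ℝ → ℝ) (τ : (ℕ → ℝ) → ℕ∞) {d : ℝ≥0∞}
    [∀ j, IsProbabilityMeasure (changeLaw ref f₀ G (j + 1))]
    (h : ∀ j B, MeasurableSet[obsFiltration j] B →
      ∫⁻ x in B, delay τ (j + 1) x ∂changeLaw ref f₀ G (j + 1) ≤
        d * changeLaw ref f₀ G (j + 1) B) :
    WADD ref f₀ G τ ≤ d := by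
  refine iSup₂_le fun ν hν => ?_
  obtain ⟨j, rfl⟩ : ∃ j, ν = j + 1 := ⟨ν - 1, by omega⟩
  rw [Nat.add_sub_cancel]
  set P := changeLaw ref f₀ G (j + 1) with hP
  refine essSup_le_of_ae_le _ ?_
  refine ae_le_of_ae_le_trim (hm := obsFiltration.le j) ?_
  refine ae_le_of_forall_setLIntegral_le_of_sigmaFinite (measurable_condLExp _ _ _)
    fun s hs _ => ?_
  rw [setLIntegral_condLExp_trim _ _ _ hs, setLIntegral_const,
    trim_measurableSet_eq (obsFiltration.le j) hs]
  exact h j s hs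

/-- The bound on the conditional delay may be averaged with any nonnegative weight that the
observations before the change determine; the lower bound uses reflection weights. -/
lemma lintegral_mul_delay_le_WADD (ref : Measure ℝ) (f₀ : ℝ → ℝ) (G : ℕ → ℕ → ℝ → ℝ)
    {τ : (ℕ → ℝ) → ℕ∞} (hτ : IsStoppingTime obsFiltration τ)
    [∀ j, IsProbabilityMeasure (changeLaw ref f₀ G (j + 1))] (j : ℕ) {g : (ℕ → ℝ) → ℝ≥0∞}
    (hg : Measurable g) (hd : DependsOn g (Iio j)) :
    ∫⁻ x, g x * delay τ (j + 1) x ∂changeLaw ref f₀ G (j + 1) ≤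
      WADD ref f₀ G τ * ∫⁻ x, g x ∂changeLaw ref f₀ G (j + 1) := by
  set P := changeLaw ref f₀ G (j + 1) with hP
  have hm := obsFiltration.le j
  have hgF : Measurable[obsFiltration j] g := measurable_obsFiltration_iff.2 ⟨hg, hd⟩
  have hW : ∀ᵐ x ∂P, condLExp (obsFiltration j) P (delay τ (j + 1)) x ≤ WADD ref f₀ G τ := by
    filter_upwards [ENNReal.ae_le_essSup (μ := P)
      (condLExp (obsFiltration j) P (delay τ (j + 1)))] with x hx
    refine hx.trans ?_
    exact le_iSup₂_of_le (f := fun (ν : ℕ) (_ : 1 ≤ ν) =>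
      essSup (condLExp (obsFiltration (ν - 1)) (changeLaw ref f₀ G ν) (delay τ ν))
        (changeLaw ref f₀ G ν)) (j + 1) (by omega) le_rfl
  have hle : (P.withDensity (delay τ (j + 1))).trim hm ≤ WADD ref f₀ G τ • P.trim hm := by
    refine Measure.le_intro fun s hs _ => ?_
    rw [Measure.smul_apply, trim_measurableSet_eq hm hs, trim_measurableSet_eq hm hs,
      withDensity_apply _ (hm s hs), ← setLIntegral_condLExp hm P _ hs, smul_eq_mul,
      ← setLIntegral_const]
    exact lintegral_mono_ae (ae_restrict_of_ae hW)
  calc ∫⁻ x, g x * delay τ (j + 1) x ∂P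
      = ∫⁻ x, g x ∂(P.withDensity (delay τ (j + 1))) := by
        rw [lintegral_withDensity_eq_lintegral_mul _ (measurable_delay hτ j) hg]
        exact lintegral_congr fun x => mul_comm _ _
    _ = ∫⁻ x, g x ∂(P.withDensity (delay τ (j + 1))).trim hm := (lintegral_trim hm hgF).symm
    _ ≤ ∫⁻ x, g x ∂(WADD ref f₀ G τ • P.trim hm) := lintegral_mono' hle le_rfl
    _ = WADD ref f₀ G τ * ∫⁻ x, g x ∂P := by
        rw [lintegral_smul_measure, lintegral_trim hm hgF, smul_eq_mul]

end PathSpace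

/-! ### Stochastic order: from closed half-lines to antitone functions -/

section StochasticOrder

/-- A nonempty upper set of ℝ is a closed half-line, an open half-line or the whole line. The last
two are increasing unions of closed half-lines. -/
lemma measure_le_of_stochLarger {P Q : Measure ℝ} (h : StochLarger Q P) {U : Set ℝ}
    (hU : IsUpperSet U) : P U ≤ Q U := by
  have hmono : Monotone fun n : ℕ => {x : ℝ | x - 1 / ((n : ℝ) + 1) ∈ U} := by
    intro a b hab x hx
    refine hU ?_ hx
    have : 1 / ((b : ℝ) + 1) ≤ 1 / ((a : ℝ) + 1) :=
      one_div_le_one_div_of_le (by positivity) (by exact_mod_cast Nat.succ_le_succ hab)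
    linarith
  rcases U.eq_empty_or_nonempty with rfl | hne
  · simp
  by_cases hb : BddBelow U
  · set a := sInf U
    by_cases ha : a ∈ U
    · have : U = Ici a := by
        ext x
        exact ⟨fun hx => csInf_le hb hx, fun hx => hU hx ha⟩
      rw [this]; exact h a
    · have hUI : U = ⋃ n : ℕ, Ici (a + 1 / ((n : ℝ) + 1)) := by
        ext x
        simp only [mem_iUnion, mem_Ici]
        constructor
        · intro hx
          have hlt : a < x := lt_of_le_of_ne (csInf_le hb hx) (by rintro rfl; exact ha hx)
          obtain ⟨n, hn⟩ := exists_nat_one_div_lt (sub_pos.2 hlt)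
          exact ⟨n, by linarith⟩
        · rintro ⟨n, hn⟩
          have : a < x := lt_of_lt_of_le (by linarith [Nat.one_div_pos_of_nat (α := ℝ) (n := n)]) hn
          obtain ⟨y, hy, hyx⟩ := exists_lt_of_csInf_lt hne this
          exact hU hyx.le hy
      have hm : Monotone fun n : ℕ => Ici (a + 1 / ((n : ℝ) + 1)) := by
        intro m n hmn
        refine Ici_subset_Ici.2 ?_
        have := one_div_le_one_div_of_le (a := (m : ℝ) + 1) (b := (n : ℝ) + 1) (by positivity)
          (by exact_mod_cast Nat.succ_le_succ hmn)
        linarith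
      rw [hUI, hm.measure_iUnion, hm.measure_iUnion]
      exact iSup_mono fun n => h _
  · have hUI : U = ⋃ n : ℕ, Ici (-(n : ℝ)) := by
      ext x
      simp only [mem_iUnion, mem_Ici]
      constructor
      · intro _
        obtain ⟨n, hn⟩ := exists_nat_ge (-x)
        exact ⟨n, by linarith⟩
      · intro _
        obtain ⟨y, hy, hyx⟩ := not_bddBelow_iff.1 hb x
        exact hU hyx.le hy
    have hm : Monotone fun n : ℕ => Ici (-(n : ℝ)) := by
      intro m n hmn
      exact Ici_subset_Ici.2 (neg_le_neg (by exact_mod_cast hmn))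
    rw [hUI, hm.measure_iUnion, hm.measure_iUnion]
    exact iSup_mono fun n => h _

/-- Layer-cake formula: the complement of a superlevel set of an antitone function is an upper set.
-/
lemma lintegral_le_of_stochLarger {P Q : Measure ℝ} [IsProbabilityMeasure P]
    [IsProbabilityMeasure Q] (h : StochLarger Q P) {f : ℝ → ℝ≥0∞} (hf : Antitone f)
    (hf1 : ∀ x, f x ≤ 1) : ∫⁻ x, f x ∂Q ≤ ∫⁻ x, f x ∂P := by
  have hm : Measurable f := hf.measurable
  have hfin : ∀ x, f x ≠ ⊤ := fun x => ne_top_of_le_ne_top ENNReal.one_ne_top (hf1 x)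
  have hr : ∀ ρ : Measure ℝ, (∫⁻ x, f x ∂ρ) = ∫⁻ t in Ioi 0, ρ {x | t < (f x).toReal} := by
    intro ρ
    rw [← lintegral_eq_lintegral_meas_lt ρ (Filter.Eventually.of_forall fun x =>
      ENNReal.toReal_nonneg) hm.ennreal_toReal.aemeasurable]
    exact lintegral_congr fun x => (ENNReal.ofReal_toReal (hfin x)).symm
  rw [hr, hr]
  refine lintegral_mono fun t => ?_
  have hU : IsUpperSet {x | t < (f x).toReal}ᶜ := by
    intro x y hxy hx hy
    exact hx (lt_of_lt_of_le hy (ENNReal.toReal_mono (hfin x) (hf hxy)))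
  have hms : MeasurableSet {x | t < (f x).toReal} :=
    measurableSet_lt measurable_const hm.ennreal_toReal
  have := measure_le_of_stochLarger h hU
  rw [prob_compl_eq_one_sub hms, prob_compl_eq_one_sub hms] at this
  exact (ENNReal.sub_le_sub_iff_left prob_le_one ENNReal.one_ne_top).1 this

end StochasticOrder

/-! ### Survival probabilities of a reflected random walk -/

section Survival

/-- The probability that a CUSUM statistic which starts at `max u 0` and has increments `ℓ v`,
`v ∼ μ`, stays below `A` during the next `k` steps. -/
noncomputable def survival (μ : Measure ℝ) (ℓ : ℝ → ℝ) (A : ℝ) : ℕ → ℝ → ℝ≥0∞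
  | 0, _ => 1
  | k + 1, u => ∫⁻ v, if max u 0 + ℓ v < A then survival μ ℓ A k (max u 0 + ℓ v) else 0 ∂μ

variable {μ : Measure ℝ} {ℓ : ℝ → ℝ} {A : ℝ}

lemma measurable_survival_integrand {f : ℝ → ℝ≥0∞} (hf : Measurable f) (hℓ : Measurable ℓ) :
    Measurable fun q : ℝ × ℝ => if max q.1 0 + ℓ q.2 < A then f (max q.1 0 + ℓ q.2) else 0 := by
  have h : Measurable fun q : ℝ × ℝ => max q.1 0 + ℓ q.2 := by fun_prop
  exact Measurable.ite (measurableSet_lt h measurable_const) (hf.comp h) measurable_const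

lemma measurable_survival [SFinite μ] (hℓ : Measurable ℓ) (k : ℕ) : Measurable (survival μ ℓ A k) := by
  induction k with
  | zero => exact measurable_const
  | succ k ih => exact (measurable_survival_integrand ih hℓ).lintegral_prod_right'

lemma survival_max (k : ℕ) (u : ℝ) : survival μ ℓ A k (max u 0) = survival μ ℓ A k u := by
  cases k with
  | zero => rfl
  | succ k => simp only [survival, max_assoc, max_self]

lemma survival_le_one [IsProbabilityMeasure μ] (k : ℕ) (u : ℝ) : survival μ ℓ A k u ≤ 1 := by
  induction k generalizing u with
  | zero => exact le_rfl
  | succ k ih =>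
    calc survival μ ℓ A (k + 1) u ≤ ∫⁻ _, 1 ∂μ := by
          refine lintegral_mono fun v => ?_
          split_ifs
          · exact ih _
          · exact zero_le
      _ = 1 := by simp

lemma survival_antitone (k : ℕ) : Antitone (survival μ ℓ A k) := by
  induction k with
  | zero => exact fun _ _ _ => le_rfl
  | succ k ih =>
    intro u u' h
    refine lintegral_mono fun v => ?_
    have h1 : max u 0 + ℓ v ≤ max u' 0 + ℓ v := by gcongr
    by_cases h2 : max u' 0 + ℓ v < A
    · simp only [if_pos h2, if_pos (h1.trans_lt h2)]
      exact ih h1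
    · simp only [if_neg h2, zero_le]

lemma survival_le_zero (k : ℕ) (u : ℝ) : survival μ ℓ A k u ≤ survival μ ℓ A k 0 := by
  rw [← survival_max k u]
  exact survival_antitone k (le_max_right _ _)

/-- Markov property after `k` steps: the remaining `m` steps are survived most easily from the
lowest state, 0. -/
lemma survival_add_le [IsProbabilityMeasure μ] (m k : ℕ) (u : ℝ) :
    survival μ ℓ A (k + m) u ≤ survival μ ℓ A m 0 * survival μ ℓ A k u := by
  induction k generalizing u with
  | zero => simpa [survival] using survival_le_zero m u
  | succ k ih =>
    have hfin : survival μ ℓ A m 0 ≠ ⊤ := ne_top_of_le_ne_top ENNReal.one_ne_top (survival_le_one _ _)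
    rw [Nat.succ_add]
    simp only [survival]
    rw [← lintegral_const_mul' _ _ hfin]
    refine lintegral_mono fun v => ?_
    split_ifs
    · exact ih _
    · exact zero_le

/-- If the increments exceed `ε > 0` with positive probability, then the statistic cannot stay below
`A` with probability one. -/
lemma exists_survival_lt_one [IsProbabilityMeasure μ] (hℓ : Measurable ℓ) (hA : 0 < A) {ε : ℝ} (hε : 0 < ε)
    (hμ : μ {v | ε ≤ ℓ v} ≠ 0) : ∃ m, survival μ ℓ A m 0 < 1 := by
  set δ := μ {v | ε ≤ ℓ v} with hδ
  have hδ1 : δ ≤ 1 := prob_le_one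
  have hms : MeasurableSet {v | ε ≤ ℓ v} := measurableSet_le measurable_const hℓ
  -- If `k` increments of size `ε` suffice to reach `A`, a run of `k` such increments has
  -- probability at least `δ ^ k` and ends survival. Together with `0 < A`, the condition `u < A`
  -- makes the case `k = 0` vacuous.
  have key : ∀ k : ℕ, ∀ u, A ≤ max u 0 + k * ε → u < A →
      survival μ ℓ A k u ≤ 1 - δ ^ k := by
    intro k
    induction k with
    | zero =>
      intro u h1 h2
      rcases le_total u 0 with h | h
      · simp [max_eq_right h] at h1; linarith
      · simp [max_eq_left h] at h1; linarith
    | succ k ih =>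
      intro u h1 _
      have hb : ∀ v, (if max u 0 + ℓ v < A then survival μ ℓ A k (max u 0 + ℓ v) else 0) ≤
          {v | ε ≤ ℓ v}.indicator (fun _ => 1 - δ ^ k) v +
            {v | ε ≤ ℓ v}ᶜ.indicator (fun _ => 1) v := by
        intro v
        by_cases hv : ε ≤ ℓ v
        · rw [indicator_of_mem (show v ∈ {v | ε ≤ ℓ v} from hv)]
          refine le_trans ?_ le_self_add
          split_ifs with h3
          · refine ih _ ?_ h3
            push_cast at h1
            have : max u 0 + ℓ v ≤ max (max u 0 + ℓ v) 0 := le_max_left _ _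
            linarith
          · exact zero_le
        · rw [indicator_of_mem (show v ∈ {v | ε ≤ ℓ v}ᶜ from hv)]
          refine le_trans ?_ le_add_self
          split_ifs
          · exact survival_le_one _ _
          · exact zero_le
      have hk1 : δ ^ k ≤ 1 := pow_le_one₀ (zero_le) hδ1
      calc survival μ ℓ A (k + 1) u
          ≤ ∫⁻ v, ({v | ε ≤ ℓ v}.indicator (fun _ => 1 - δ ^ k) v +
            {v | ε ≤ ℓ v}ᶜ.indicator (fun _ => 1) v) ∂μ := lintegral_mono hb
        _ = (1 - δ ^ k) * δ + (1 - δ) := by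
          rw [lintegral_add_left (measurable_const.indicator hms), lintegral_indicator_const hms,
            lintegral_indicator_const hms.compl, prob_compl_eq_one_sub hms, one_mul]
        _ = 1 - δ ^ (k + 1) := by
          have hk : (1 - δ ^ k) * δ = δ - δ ^ (k + 1) := by
            rw [ENNReal.sub_mul (fun _ _ => ne_top_of_le_ne_top ENNReal.one_ne_top hδ1), one_mul,
              pow_succ]
          have h2 : δ ^ (k + 1) ≤ δ := by
            rw [pow_succ]; exact mul_le_of_le_one_left (zero_le) hk1
          rw [hk, add_comm]
          exact tsub_add_tsub_cancel hδ1 h2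
  obtain ⟨m, hm⟩ := exists_nat_ge (A / ε)
  refine ⟨m, (key m 0 ?_ hA).trans_lt ?_⟩
  · rw [div_le_iff₀ hε] at hm
    simpa using hm
  · exact ENNReal.sub_lt_self ENNReal.one_ne_top one_ne_zero (pow_ne_zero _ hμ)

/-- Over a block of `m` steps the survival probability shrinks by a factor `q < 1`. Hence the
partial sums satisfy S ≤ m + q S and stay bounded by m / (1 - q). -/
lemma tsum_survival_ne_top [IsProbabilityMeasure μ] (hℓ : Measurable ℓ) (hA : 0 < A) {ε : ℝ} (hε : 0 < ε)
    (hμ : μ {v | ε ≤ ℓ v} ≠ 0) : ∑' k, survival μ ℓ A k 0 ≠ ⊤ := by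
  obtain ⟨m, hm⟩ := exists_survival_lt_one hℓ hA hε hμ
  have hfin : ∀ k, survival μ ℓ A k 0 ≠ ⊤ := fun k =>
    ne_top_of_le_ne_top ENNReal.one_ne_top (survival_le_one _ _)
  set r : ℕ → ℝ := fun k => (survival μ ℓ A k 0).toReal with hr
  set q := (survival μ ℓ A m 0).toReal with hq
  have hq1 : q < 1 := by
    rw [hq, ← ENNReal.toReal_one]
    exact ENNReal.toReal_strict_mono ENNReal.one_ne_top hm
  have hr0 : ∀ k, 0 ≤ r k := fun k => ENNReal.toReal_nonneg
  have hr1 : ∀ k, r k ≤ 1 := fun k => by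
    rw [hr, ← ENNReal.toReal_one]
    exact ENNReal.toReal_mono ENNReal.one_ne_top (survival_le_one _ _)
  have hrec : ∀ k, r (k + m) ≤ q * r k := fun k => by
    simp only [hr, hq]
    rw [← ENNReal.toReal_mul]
    exact ENNReal.toReal_mono (ENNReal.mul_ne_top (hfin _) (hfin _))
      (survival_add_le m k 0)
  have hbound : ∀ n, ∑ k ∈ Finset.range n, r k ≤ m / (1 - q) := by
    intro n
    rw [le_div_iff₀ (by linarith)]
    have h1 : ∑ k ∈ Finset.range n, r k ≤ ∑ k ∈ Finset.range (m + n), r k :=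
      Finset.sum_le_sum_of_subset_of_nonneg (Finset.range_mono (by omega)) fun k _ _ => hr0 k
    rw [Finset.sum_range_add] at h1
    have h2 : ∑ k ∈ Finset.range m, r k ≤ m := by
      simpa using Finset.sum_le_card_nsmul (Finset.range m) r 1 fun k _ => hr1 k
    have h3 : ∑ k ∈ Finset.range n, r (m + k) ≤ q * ∑ k ∈ Finset.range n, r k := by
      rw [Finset.mul_sum]
      exact Finset.sum_le_sum fun k _ => by rw [add_comm]; exact hrec k
    linarith
  have hs : Summable r := summable_of_sum_range_le hr0 hbound
  have : ∀ k, survival μ ℓ A k 0 = ENNReal.ofReal (r k) := fun k =>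
    (ENNReal.ofReal_toReal (hfin k)).symm
  simp_rw [this]
  exact hs.tsum_ofReal_ne_top

end Survival

/-! ### The CUSUM test and the upper bound on its worst-case delay -/

section Cusum

variable {f₁ f₀ : ℝ → ℝ} {A : ℝ}

lemma cusum_nonneg (x : ℕ → ℝ) (m : ℕ) : 0 ≤ cusum f₁ f₀ x m := by
  cases m with
  | zero => exact le_rfl
  | succ m => exact le_max_left _ _

lemma measurable_cusum (hℓ : Measurable (llr f₁ f₀)) (m : ℕ) :
    Measurable fun x => cusum f₁ f₀ x m := by
  induction m with
  | zero => exact measurable_const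
  | succ m ih =>
    exact measurable_const.max (ih.add (hℓ.comp (measurable_pi_apply m)))

lemma dependsOn_cusum (m : ℕ) : DependsOn (fun x => cusum f₁ f₀ x m) (Iio m) := by
  induction m with
  | zero => exact fun _ _ _ => rfl
  | succ m ih =>
    intro x y hxy
    have h1 : cusum f₁ f₀ x m = cusum f₁ f₀ y m :=
      ih fun i hi => hxy i (lt_trans hi (Nat.lt_succ_self m))
    simp only [cusum, h1, hxy m (Nat.lt_succ_self m)]

lemma lt_cusumTime_iff (k : ℕ) (x : ℕ → ℝ) :
    (k : ℕ∞) < cusumTime f₁ f₀ A x ↔ ∀ m, 1 ≤ m → m ≤ k → cusum f₁ f₀ x m < A := by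
  constructor
  · intro h m h1 hk
    by_contra hA
    have : cusumTime f₁ f₀ A x ≤ (m : ℕ∞) := iInf₂_le m ⟨h1, not_lt.1 hA⟩
    exact absurd (h.trans_le this) (not_lt.2 (by exact_mod_cast hk))
  · intro h
    have : ((k + 1 : ℕ) : ℕ∞) ≤ cusumTime f₁ f₀ A x := by
      refine le_iInf₂ fun m hm => ?_
      rw [Nat.cast_le]
      by_contra hk
      exact absurd (h m hm.1 (by omega)) (not_lt.2 hm.2)
    exact lt_of_lt_of_le (by exact_mod_cast Nat.lt_succ_self k) this

lemma lt_cusumTime_succ_iff (k : ℕ) (x : ℕ → ℝ) :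
    ((k + 1 : ℕ) : ℕ∞) < cusumTime f₁ f₀ A x ↔
      (k : ℕ∞) < cusumTime f₁ f₀ A x ∧ cusum f₁ f₀ x (k + 1) < A := by
  rw [lt_cusumTime_iff, lt_cusumTime_iff]
  constructor
  · exact fun h => ⟨fun m h1 hk => h m h1 (by omega), h _ (by omega) le_rfl⟩
  · rintro ⟨h1, h2⟩ m hm hk
    rcases Nat.lt_or_ge m (k + 1) with h | h
    · exact h1 m hm (by omega)
    · obtain rfl : m = k + 1 := le_antisymm hk h
      exact h2

lemma one_le_cusumTime (x : ℕ → ℝ) : 1 ≤ cusumTime f₁ f₀ A x :=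
  le_iInf₂ fun m hm => by exact_mod_cast hm.1

lemma isStoppingTime_cusumTime (hℓ : Measurable (llr f₁ f₀)) :
    IsStoppingTime obsFiltration (cusumTime f₁ f₀ A) := by
  intro k
  have h : MeasurableSet[obsFiltration k] {x | (k : ℕ∞) < cusumTime f₁ f₀ A x} := by
    refine measurableSet_obsFiltration_iff.2 ⟨?_, ?_⟩
    · have : {x | (k : ℕ∞) < cusumTime f₁ f₀ A x} =
          ⋂ (m : ℕ) (_ : 1 ≤ m) (_ : m ≤ k), {x | cusum f₁ f₀ x m < A} := by
        ext x
        simp only [mem_iInter]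
        exact lt_cusumTime_iff k x
      rw [this]
      exact MeasurableSet.iInter fun m => MeasurableSet.iInter fun _ => MeasurableSet.iInter
        fun _ => measurableSet_lt (measurable_cusum hℓ m) measurable_const
    · intro x y hxy
      refine propext ?_
      refine (lt_cusumTime_iff k x).trans (Iff.trans ?_ (lt_cusumTime_iff k y).symm)
      refine forall₃_congr fun m _ hk => ?_
      have h : cusum f₁ f₀ x m = cusum f₁ f₀ y m :=
        dependsOn_cusum m fun i hi => hxy i (lt_of_lt_of_le hi hk)
      rw [h]
  have h2 := h.compl
  convert h2 using 1
  ext x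
  exact (not_lt (a := (k : ℕ∞)) (b := cusumTime f₁ f₀ A x)).symm

/-- The weight `b` on the past, times the indicator of `{τ_A > i}`, times a function of `W_i`. -/
lemma lintegral_survival_succ (μ : ℕ → Measure ℝ) [∀ i, IsProbabilityMeasure (μ i)]
    (hℓ : Measurable (llr f₁ f₀)) (hA : 0 < A) {b : (ℕ → ℝ) → ℝ≥0∞} {i : ℕ} (hb : Measurable b)
    (hd : DependsOn b (Iio i)) {F : ℝ → ℝ≥0∞} (hF : Measurable F) (hFmax : ∀ u, F (max u 0) = F u) :
    ∫⁻ x, b x * (if ((i + 1 : ℕ) : ℕ∞) < cusumTime f₁ f₀ A x then 1 else 0) *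
        F (cusum f₁ f₀ x (i + 1)) ∂Measure.infinitePi μ =
      ∫⁻ x, b x * (if (i : ℕ∞) < cusumTime f₁ f₀ A x then 1 else 0) *
        (∫⁻ v, (if max (cusum f₁ f₀ x i) 0 + llr f₁ f₀ v < A then
          F (max (cusum f₁ f₀ x i) 0 + llr f₁ f₀ v) else 0) ∂μ i) ∂Measure.infinitePi μ := by
  have hτ : IsStoppingTime obsFiltration (cusumTime f₁ f₀ A) := isStoppingTime_cusumTime hℓ
  have hm : Measurable fun x => b x *
      (if ((i + 1 : ℕ) : ℕ∞) < cusumTime f₁ f₀ A x then (1 : ℝ≥0∞) else 0) *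
      F (cusum f₁ f₀ x (i + 1)) :=
    (hb.mul (measurable_ite_lt hτ (i + 1))).mul (hF.comp (measurable_cusum hℓ (i + 1)))
  rw [lintegral_infinitePi_update μ i hm]
  refine lintegral_congr fun x => ?_
  have hmi : Measurable fun v => (if max (cusum f₁ f₀ x i) 0 + llr f₁ f₀ v < A then
      F (max (cusum f₁ f₀ x i) 0 + llr f₁ f₀ v) else 0) :=
    (measurable_survival_integrand hF hℓ).comp measurable_prodMk_left
  rw [← lintegral_const_mul _ hmi]
  refine lintegral_congr fun v => ?_
  have hag : ∀ j ∈ Iio i, Function.update x i v j = x j := fun j hj =>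
    Function.update_of_ne (ne_of_lt hj) _ _
  have h1 : b (Function.update x i v) = b x := hd hag
  have h2 : ((i : ℕ∞) < cusumTime f₁ f₀ A (Function.update x i v)) =
      ((i : ℕ∞) < cusumTime f₁ f₀ A x) :=
    (measurableSet_obsFiltration_iff.1 (measurableSet_lt_stoppingTime hτ i)).2 hag
  have h3 : cusum f₁ f₀ (Function.update x i v) i = cusum f₁ f₀ x i := dependsOn_cusum i hag
  have h4 : cusum f₁ f₀ (Function.update x i v) (i + 1) =
      max (max (cusum f₁ f₀ x i) 0 + llr f₁ f₀ v) 0 := by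
    rw [cusum, h3, Function.update_self, max_comm, max_eq_left (cusum_nonneg x i)]
  rw [h1, h4, hFmax]
  -- Since `0 < A`, the reflected statistic is below `A` exactly when the unreflected one is.
  simp only [lt_cusumTime_succ_iff, h2, h4, max_lt_iff, hA, and_true, ite_and]
  split_ifs <;> simp

variable {ρ : Measure ℝ} [IsProbabilityMeasure ρ]

/-- The observations after time `j` are replaced by draws from `ρ` one at a time, starting with the
last. The chance of surviving the rest is antitone in the increment, so the stochastic order makes
each replacement increase the integral. -/
lemma lintegral_survival_le (μ : ℕ → Measure ℝ) [∀ i, IsProbabilityMeasure (μ i)]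
    (hℓ : Measurable (llr f₁ f₀)) (hA : 0 < A) {b : (ℕ → ℝ) → ℝ≥0∞} {j : ℕ} (hb : Measurable b)
    (hd : DependsOn b (Iio j))
    (hμ : ∀ i, j ≤ i → StochLarger ((μ i).map (llr f₁ f₀)) (ρ.map (llr f₁ f₀))) (k m : ℕ) :
    ∫⁻ x, b x * (if ((j + k : ℕ) : ℕ∞) < cusumTime f₁ f₀ A x then 1 else 0) *
        survival ρ (llr f₁ f₀) A m (cusum f₁ f₀ x (j + k)) ∂Measure.infinitePi μ ≤
      ∫⁻ x, b x * (if (j : ℕ∞) < cusumTime f₁ f₀ A x then 1 else 0) *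
        survival ρ (llr f₁ f₀) A (m + k) (cusum f₁ f₀ x j) ∂Measure.infinitePi μ := by
  induction k generalizing m with
  | zero => exact le_rfl
  | succ k ih =>
    have hd' : DependsOn b (Iio (j + k)) := fun x y hxy => hd fun i hi =>
      hxy i (lt_of_lt_of_le hi (Nat.le_add_right _ _))
    rw [← add_assoc, lintegral_survival_succ μ hℓ hA hb hd' (measurable_survival hℓ m)
      (survival_max m)]
    refine le_trans (lintegral_mono fun x => ?_) ((ih (m + 1)).trans_eq (by
      rw [add_right_comm, add_assoc]))
    gcongr
    set w := max (cusum f₁ f₀ x (j + k)) 0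
    have hanti : Antitone fun l : ℝ => if w + l < A then survival ρ (llr f₁ f₀) A m (w + l)
        else 0 := by
      intro l l' hl
      by_cases h : w + l' < A
      · simp only [if_pos h, if_pos (show w + l < A by linarith)]
        exact survival_antitone m (by linarith)
      · simp only [if_neg h, zero_le]
    have hle1 : ∀ l : ℝ, (if w + l < A then survival ρ (llr f₁ f₀) A m (w + l) else 0) ≤ 1 := by
      intro l
      split_ifs
      · exact survival_le_one _ _
      · exact zero_le
    have : IsProbabilityMeasure ((μ (j + k)).map (llr f₁ f₀)) :=
      Measure.isProbabilityMeasure_map hℓ.aemeasurable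
    have : IsProbabilityMeasure (ρ.map (llr f₁ f₀)) :=
      Measure.isProbabilityMeasure_map hℓ.aemeasurable
    have h := lintegral_le_of_stochLarger (hμ (j + k) (by omega)) hanti hle1
    rwa [lintegral_map hanti.measurable hℓ, lintegral_map hanti.measurable hℓ] at h

lemma lintegral_survival_eq (hℓ : Measurable (llr f₁ f₀)) (hA : 0 < A) (k m : ℕ) :
    ∫⁻ x, (if (k : ℕ∞) < cusumTime f₁ f₀ A x then 1 else 0) *
        survival ρ (llr f₁ f₀) A m (cusum f₁ f₀ x k) ∂Measure.infinitePi (fun _ => ρ) =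
      survival ρ (llr f₁ f₀) A (m + k) 0 := by
  induction k generalizing m with
  | zero =>
    have : ∀ x, ((0 : ℕ) : ℕ∞) < cusumTime f₁ f₀ A x := fun x =>
      lt_of_lt_of_le (by norm_num) (one_le_cusumTime x)
    simp only [this, if_true, cusum, one_mul, add_zero]
    simp
  | succ k ih =>
    have h := lintegral_survival_succ (fun _ => ρ) hℓ hA (b := fun _ => 1) (i := k) measurable_const
      (fun _ _ _ => rfl) (measurable_survival (μ := ρ) (A := A) hℓ m) (survival_max m)
    simp only [one_mul] at h
    rw [h, show m + (k + 1) = (m + 1) + k by omega, ← ih (m + 1)]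
    rfl

lemma MFA_cusumTime (ref : Measure ℝ) [IsProbabilityMeasure (law ref f₀)]
    (hℓ : Measurable (llr f₁ f₀)) (hA : 0 < A) :
    MFA ref f₀ (cusumTime f₁ f₀ A) = ∑' k, survival (law ref f₀) (llr f₁ f₀) A k 0 := by
  have hτ : IsStoppingTime obsFiltration (cusumTime f₁ f₀ A) := isStoppingTime_cusumTime hℓ
  rw [MFA_eq_tsum _ _ _ fun k => obsFiltration.le k _ (measurableSet_lt_stoppingTime hτ k)]
  refine tsum_congr fun k => ?_
  have h := lintegral_survival_eq (ρ := law ref f₀) hℓ hA k 0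
  rw [zero_add] at h
  rw [← h, ← lintegral_indicator_one
    (obsFiltration.le k _ (measurableSet_lt_stoppingTime hτ k))]
  exact lintegral_congr fun x => by simp [indicator_apply, survival]

lemma isProbabilityMeasure_changeLaw {ref : Measure ℝ} [IsProbabilityMeasure (law ref f₀)]
    {G : ℕ → ℕ → ℝ → ℝ} (hG : ∀ m ν, 1 ≤ m → 1 ≤ ν → IsProbabilityMeasure (law ref (G m ν)))
    (j : ℕ) : IsProbabilityMeasure (changeLaw ref f₀ G (j + 1)) := by
  have (k : ℕ) : IsProbabilityMeasure
      (law ref (if k + 1 < j + 1 then f₀ else G (k + 1) (j + 1))) := by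
    split_ifs
    · infer_instance
    · exact hG _ _ (by omega) (by omega)
  unfold changeLaw
  infer_instance

/-- The worst-case delay of the CUSUM test is at most the mean delay from `W_0 = 0` under the least
favorable law. -/
lemma WADD_cusumTime_le (ref : Measure ℝ) (G : ℕ → ℕ → ℝ → ℝ) [IsProbabilityMeasure (law ref f₀)]
    [IsProbabilityMeasure (law ref f₁)]
    (hG : ∀ m ν, 1 ≤ m → 1 ≤ ν → IsProbabilityMeasure (law ref (G m ν)))
    (hS : ∀ m ν, 1 ≤ m → 1 ≤ ν →
      StochLarger ((law ref (G m ν)).map (llr f₁ f₀)) ((law ref f₁).map (llr f₁ f₀)))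
    (hℓ : Measurable (llr f₁ f₀)) (hA : 0 < A) :
    WADD ref f₀ G (cusumTime f₁ f₀ A) ≤ ∑' k, survival (law ref f₁) (llr f₁ f₀) A k 0 := by
  have hτ : IsStoppingTime obsFiltration (cusumTime f₁ f₀ A) := isStoppingTime_cusumTime hℓ
  have := isProbabilityMeasure_changeLaw (ref := ref) (f₀ := f₀) hG
  refine WADD_le ref f₀ G _ fun j B hB => ?_
  have hpr : ∀ k, IsProbabilityMeasure
      (law ref (if k + 1 < j + 1 then f₀ else G (k + 1) (j + 1))) := by
    intro k
    split_ifs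
    · infer_instance
    · exact hG _ _ (by omega) (by omega)
  obtain ⟨hBm, hBd⟩ := measurableSet_obsFiltration_iff.1 hB
  have hbm : Measurable (B.indicator (fun _ => (1 : ℝ≥0∞))) := measurable_const.indicator hBm
  have hbd : DependsOn (B.indicator (fun _ => (1 : ℝ≥0∞))) (Iio j) := by
    intro x y hxy
    have hiff : x ∈ B ↔ y ∈ B := iff_of_eq (hBd hxy)
    by_cases hx : x ∈ B
    · exact (indicator_of_mem hx fun _ => (1 : ℝ≥0∞)).trans
        (indicator_of_mem (hiff.1 hx) fun _ => (1 : ℝ≥0∞)).symm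
    · exact (indicator_of_notMem hx fun _ => (1 : ℝ≥0∞)).trans
        (indicator_of_notMem (fun h => hx (hiff.2 h)) fun _ => (1 : ℝ≥0∞)).symm
  rw [← lintegral_indicator hBm]
  have hk : ∀ k : ℕ, ∫⁻ x, B.indicator (fun _ => (1 : ℝ≥0∞)) x *
      (if ((j + k : ℕ) : ℕ∞) < cusumTime f₁ f₀ A x then 1 else 0) ∂changeLaw ref f₀ G (j + 1) ≤
      survival (law ref f₁) (llr f₁ f₀) A k 0 * changeLaw ref f₀ G (j + 1) B := by
    intro k
    have h := lintegral_survival_le (ρ := law ref f₁)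
      (fun k => law ref (if k + 1 < j + 1 then f₀ else G (k + 1) (j + 1))) hℓ hA hbm hbd
      (fun i hi => by
        rw [if_neg (by omega)]
        exact hS _ _ (by omega) (by omega)) k 0
    simp only [survival, mul_one, zero_add] at h
    refine h.trans ?_
    rw [← lintegral_indicator_one hBm, ← lintegral_const_mul _ (measurable_one.indicator hBm)]
    refine lintegral_mono fun x => ?_
    rw [mul_comm (survival _ _ _ _ _)]
    -- Whatever the past, the start at `W_j = 0` is the worst; this removes the conditioning.
    refine mul_le_mul' ?_ (survival_le_zero _ _)
    refine (mul_le_of_le_one_right zero_le ?_).trans_eq rfl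
    split_ifs <;> simp
  calc ∫⁻ x, B.indicator (delay (cusumTime f₁ f₀ A) (j + 1)) x ∂changeLaw ref f₀ G (j + 1)
      = ∫⁻ x, ∑' k : ℕ, B.indicator (fun _ => (1 : ℝ≥0∞)) x *
          (if ((j + k : ℕ) : ℕ∞) < cusumTime f₁ f₀ A x then 1 else 0)
          ∂changeLaw ref f₀ G (j + 1) := by
        refine lintegral_congr fun x => ?_
        rw [ENNReal.tsum_mul_left, ← delay_succ]
        by_cases hx : x ∈ B <;> simp [hx]
    _ = ∑' k : ℕ, ∫⁻ x, B.indicator (fun _ => (1 : ℝ≥0∞)) x *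
          (if ((j + k : ℕ) : ℕ∞) < cusumTime f₁ f₀ A x then 1 else 0)
          ∂changeLaw ref f₀ G (j + 1) :=
        lintegral_tsum fun k => (hbm.mul (measurable_ite_lt hτ (j + k))).aemeasurable
    _ ≤ ∑' k : ℕ, survival (law ref f₁) (llr f₁ f₀) A k 0 * changeLaw ref f₀ G (j + 1) B :=
        ENNReal.tsum_le_tsum hk
    _ = _ := ENNReal.tsum_mul_right

end Cusum

/-! ### Mean run lengths and the potential of the Lagrangian stopping problem -/

section RunLength

/-- The mean number of steps until a CUSUM statistic which starts at `max u 0` and has increments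
`ℓ v`, `v ∼ μ`, reaches `A`. -/
noncomputable def runLength (μ : Measure ℝ) (ℓ : ℝ → ℝ) (A u : ℝ) : ℝ≥0∞ := ∑' k, survival μ ℓ A k u

variable {μ : Measure ℝ} {ℓ : ℝ → ℝ} {A : ℝ}

lemma runLength_max (u : ℝ) : runLength μ ℓ A (max u 0) = runLength μ ℓ A u :=
  tsum_congr fun k => survival_max k u

lemma runLength_le_zero (u : ℝ) : runLength μ ℓ A u ≤ runLength μ ℓ A 0 :=
  ENNReal.tsum_le_tsum fun k => survival_le_zero k u

lemma one_le_runLength (u : ℝ) : 1 ≤ runLength μ ℓ A u :=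
  ENNReal.le_tsum (f := fun k => survival μ ℓ A k u) 0

lemma measurable_runLength [SFinite μ] (hℓ : Measurable ℓ) : Measurable (runLength μ ℓ A) :=
  Measurable.tsum fun k => measurable_survival hℓ k

lemma runLength_eq [SFinite μ] (hℓ : Measurable ℓ) (u : ℝ) :
    runLength μ ℓ A u =
      1 + ∫⁻ v, (if max u 0 + ℓ v < A then runLength μ ℓ A (max u 0 + ℓ v) else 0) ∂μ := by
  have h : ∀ v, (if max u 0 + ℓ v < A then runLength μ ℓ A (max u 0 + ℓ v) else 0) =
      ∑' k, (if max u 0 + ℓ v < A then survival μ ℓ A k (max u 0 + ℓ v) else 0) := by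
    intro v
    split_ifs
    · rfl
    · simp
  simp_rw [h]
  have hm : ∀ k, Measurable fun v =>
      (if max u 0 + ℓ v < A then survival μ ℓ A k (max u 0 + ℓ v) else 0) := fun k =>
    (measurable_survival_integrand (measurable_survival hℓ k) hℓ).comp measurable_prodMk_left
  rw [lintegral_tsum fun k => (hm k).aemeasurable]
  exact tsum_eq_zero_add' (f := fun k => survival μ ℓ A k u) ENNReal.summable

lemma toReal_lintegral_ite [IsProbabilityMeasure μ] (hℓ : Measurable ℓ) {F : ℝ → ℝ≥0∞}
    (hF : Measurable F) (hfin : ∀ u, F u < ⊤) (u : ℝ) :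
    (∫⁻ v, (if max u 0 + ℓ v < A then F (max u 0 + ℓ v) else 0) ∂μ).toReal =
      ∫ v, (if max u 0 + ℓ v < A then (F (max u 0 + ℓ v)).toReal else 0) ∂μ := by
  rw [← integral_toReal]
  · refine integral_congr_ae (Filter.Eventually.of_forall fun v => ?_)
    dsimp only
    split_ifs <;> simp
  · exact ((measurable_survival_integrand hF hℓ).comp measurable_prodMk_left).aemeasurable
  · refine Filter.Eventually.of_forall fun v => ?_
    split_ifs
    · exact hfin _
    · simp

lemma integrable_ite [IsFiniteMeasure μ] (hℓ : Measurable ℓ) {F : ℝ → ℝ} (hF : Measurable F)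
    {K : ℝ} (hK : ∀ u < A, |F u| ≤ K) (w : ℝ) :
    Integrable (fun v => if w + ℓ v < A then F (w + ℓ v) else 0) μ := by
  have hm : Measurable fun v => w + ℓ v := by fun_prop
  refine Integrable.of_bound (C := max K 0) (Measurable.ite (measurableSet_lt hm measurable_const)
    (hF.comp hm) measurable_const).aestronglyMeasurable (Filter.Eventually.of_forall fun v => ?_)
  split_ifs with h
  · exact (hK _ h).trans (le_max_left _ _)
  · simp

/-- The cost of running the CUSUM test is monotone in the starting point if the running cost is, and
if the cost vanishes at the threshold. -/
lemma monotone_of_eq_integral [IsProbabilityMeasure μ] (hℓ : Measurable ℓ)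
    (hfin : runLength μ ℓ A 0 ≠ ⊤) {c J : ℝ → ℝ} (hc : Monotone c) (hJ : Measurable J) {K : ℝ}
    (hK : ∀ u < A, |J u| ≤ K)
    (heq : ∀ u, J u = c u + ∫ v, (if max u 0 + ℓ v < A then J (max u 0 + ℓ v) else 0) ∂μ)
    (hA : J A = 0) : Monotone J := by
  have hint : ∀ w, Integrable (fun v => if w + ℓ v < A then J (w + ℓ v) else 0) μ :=
    integrable_ite hℓ hJ hK
  have hK0 : 0 ≤ K := (abs_nonneg _).trans (hK (A - 1) (by linarith))
  have hbd : ∀ w, |∫ v, (if w + ℓ v < A then J (w + ℓ v) else 0) ∂μ| ≤ K := by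
    intro w
    have h := norm_integral_le_of_norm_le_const (μ := μ) (C := K)
      (f := fun v => if w + ℓ v < A then J (w + ℓ v) else 0)
      (Filter.Eventually.of_forall fun v => by
        split_ifs with h
        · exact hK _ h
        · simpa using hK0)
    simpa using h
  have hs1 : ∀ k u, survival μ ℓ A k u < ⊤ := fun k u =>
    (survival_le_one k u).trans_lt ENNReal.one_lt_top
  have hsr : ∀ k u, (survival μ ℓ A k u).toReal ≤ 1 := fun k u => by
    simpa using ENNReal.toReal_mono ENNReal.one_ne_top (survival_le_one k u)
  -- Two statistics started at `s ≤ t` are driven by the same increments. Their order is kept and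
  -- `c` is monotone, so the error after `k` steps is carried only by paths from `s` that still
  -- survive; it vanishes as `k → ∞`.
  have claim : ∀ k : ℕ, ∀ s t, s ≤ t → J s ≤ J t + 2 * K * (survival μ ℓ A k s).toReal := by
    intro k
    induction k with
    | zero =>
      intro s t hst
      have h1 := abs_le.1 (hbd (max s 0))
      have h2 := abs_le.1 (hbd (max t 0))
      have h3 := hc hst
      simp only [survival, ENNReal.toReal_one]
      rw [heq s, heq t]
      linarith
    | succ k ih =>
      intro s t hst
      have hsv : (survival μ ℓ A (k + 1) s).toReal = ∫ v, (if max s 0 + ℓ v < A then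
          (survival μ ℓ A k (max s 0 + ℓ v)).toReal else 0) ∂μ :=
        toReal_lintegral_ite hℓ (measurable_survival hℓ k) (hs1 k) s
      have hi : Integrable (fun v => if max s 0 + ℓ v < A then
          (survival μ ℓ A k (max s 0 + ℓ v)).toReal else 0) μ :=
        integrable_ite hℓ (F := fun u => (survival μ ℓ A k u).toReal)
          (measurable_survival hℓ k).ennreal_toReal (K := 1)
          (fun u _ => by rw [abs_of_nonneg ENNReal.toReal_nonneg]; exact hsr k u) _
      have hle : ∫ v, (if max s 0 + ℓ v < A then J (max s 0 + ℓ v) else 0) ∂μ ≤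
          ∫ v, ((if max t 0 + ℓ v < A then J (max t 0 + ℓ v) else 0) +
            2 * K * (if max s 0 + ℓ v < A then
              (survival μ ℓ A k (max s 0 + ℓ v)).toReal else 0)) ∂μ := by
        refine integral_mono (hint _) ((hint _).add (hi.const_mul _)) fun v => ?_
        have hw : max s 0 + ℓ v ≤ max t 0 + ℓ v := by gcongr
        dsimp only
        by_cases h1 : max t 0 + ℓ v < A
        · simp only [if_pos h1, if_pos (hw.trans_lt h1)]
          exact ih _ _ hw
        · by_cases h2 : max s 0 + ℓ v < A
          -- The upper path has crossed `A` and the lower one has not: the lower one is compared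
          -- with the point `A`, where `J` vanishes.
          · have h3 := ih _ _ h2.le
            simp only [if_neg h1, if_pos h2]
            rwa [hA] at h3
          · simp [if_neg h1, if_neg h2]
      rw [integral_add (hint _) (hi.const_mul _), integral_const_mul, ← hsv] at hle
      have := hc hst
      rw [heq s, heq t]
      linarith
  intro s t hst
  have hsum : Summable fun k => (survival μ ℓ A k s).toReal :=
    ENNReal.summable_toReal (ne_top_of_le_ne_top hfin (runLength_le_zero s))
  have hlim : Filter.Tendsto (fun k => J t + 2 * K * (survival μ ℓ A k s).toReal) Filter.atTop
      (nhds (J t + 2 * K * 0)) :=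
    (hsum.tendsto_atTop_zero.const_mul _).const_add _
  rw [mul_zero, add_zero] at hlim
  exact ge_of_tendsto' hlim fun k => claim k s t hst

variable {μ₁ : Measure ℝ}

/-- The optimality equation of the stopping problem that the CUSUM test solves. -/
lemma exists_potential [IsProbabilityMeasure μ] [IsProbabilityMeasure μ₁] (hℓ : Measurable ℓ)
    (hμ₁ : μ₁ = μ.withDensity fun v => ENNReal.ofReal (Real.exp (ℓ v)))
    (hN : runLength μ ℓ A 0 ≠ ⊤) (hD : runLength μ₁ ℓ A 0 ≠ ⊤) :
    ∃ (lam : ℝ≥0∞) (V : ℝ → ℝ≥0∞), lam ≠ ⊤ ∧ Measurable V ∧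
      (∀ u, runLength μ₁ ℓ A 0 * ENNReal.ofReal (1 - Real.exp u) + lam +
        ∫⁻ v, V (max u 0 + ℓ v) ∂μ ≤ ENNReal.ofReal (Real.exp (max u 0)) + V u) ∧
      runLength μ₁ ℓ A 0 + lam + ∫⁻ v, V (ℓ v) ∂μ ≤ 1 + lam * runLength μ ℓ A 0 := by
  have hNu : ∀ u, runLength μ ℓ A u < ⊤ := fun u => (runLength_le_zero u).trans_lt hN.lt_top
  have hDu : ∀ u, runLength μ₁ ℓ A u < ⊤ := fun u => (runLength_le_zero u).trans_lt hD.lt_top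
  set N : ℝ → ℝ := fun u => (runLength μ ℓ A u).toReal with hNdef
  set D : ℝ → ℝ := fun u => (runLength μ₁ ℓ A u).toReal with hDdef
  have hN1 : ∀ u, 1 ≤ N u := fun u => by
    simpa using ENNReal.toReal_mono (hNu u).ne (one_le_runLength u)
  have hD1 : ∀ u, 1 ≤ D u := fun u => by
    simpa using ENNReal.toReal_mono (hDu u).ne (one_le_runLength u)
  have hNm : Measurable N := (measurable_runLength hℓ).ennreal_toReal
  have hDm : Measurable D := (measurable_runLength hℓ).ennreal_toReal
  have hN0 : ∀ u, N u ≤ N 0 := fun u => ENNReal.toReal_mono hN (runLength_le_zero u)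
  have hD0 : ∀ u, D u ≤ D 0 := fun u => ENNReal.toReal_mono hD (runLength_le_zero u)
  have hDmax : ∀ u, D (max u 0) = D u := fun u => by simp only [hDdef, runLength_max]
  have hNabs : ∀ u < A, |N u| ≤ N 0 := fun u _ => by
    rw [abs_of_nonneg (by linarith [hN1 u])]; exact hN0 u
  have hDabs : ∀ u < A, |D u| ≤ D 0 := fun u _ => by
    rw [abs_of_nonneg (by linarith [hD1 u])]; exact hD0 u
  have hNeq : ∀ u, N u = 1 + ∫ v, (if max u 0 + ℓ v < A then N (max u 0 + ℓ v) else 0) ∂μ := by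
    intro u
    have h := toReal_lintegral_ite (μ := μ) (A := A) hℓ (measurable_runLength hℓ) hNu u
    have h2 := runLength_eq (μ := μ) (A := A) hℓ u
    have h3 := (hNu u).ne
    rw [h2] at h3
    rw [← h]
    simp only [hNdef]
    conv_lhs => rw [h2]
    rw [ENNReal.toReal_add ENNReal.one_ne_top (ENNReal.add_ne_top.1 h3).2, ENNReal.toReal_one]
  have hDeq : ∀ u, D u = 1 + ∫ v, Real.exp (ℓ v) *
      (if max u 0 + ℓ v < A then D (max u 0 + ℓ v) else 0) ∂μ := by
    intro u
    have h := toReal_lintegral_ite (μ := μ₁) (A := A) hℓ (measurable_runLength hℓ) hDu u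
    have h2 := runLength_eq (μ := μ₁) (A := A) hℓ u
    have h3 := (hDu u).ne
    rw [h2] at h3
    have h4 : D u = 1 + ∫ v, (if max u 0 + ℓ v < A then D (max u 0 + ℓ v) else 0) ∂μ₁ := by
      rw [← h]
      simp only [hDdef]
      conv_lhs => rw [h2]
      rw [ENNReal.toReal_add ENNReal.one_ne_top (ENNReal.add_ne_top.1 h3).2, ENNReal.toReal_one]
    -- Rewriting the delay equation under `μ` allows it to be combined with the equation for `N`.
    rw [h4, hμ₁, integral_withDensity_eq_integral_toReal_smul (by fun_prop)
      (Filter.Eventually.of_forall fun v => ENNReal.ofReal_lt_top)]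
    simp only [ENNReal.toReal_ofReal (Real.exp_pos _).le, smul_eq_mul]
  have hDint : ∀ u, Integrable (fun v => Real.exp (ℓ v) *
      (if max u 0 + ℓ v < A then D (max u 0 + ℓ v) else 0)) μ := by
    intro u
    have h := integrable_ite (μ := μ₁) hℓ hDm hDabs (max u 0)
    rw [hμ₁, integrable_withDensity_iff_integrable_smul' (by fun_prop)
      (Filter.Eventually.of_forall fun v => ENNReal.ofReal_lt_top)] at h
    simpa only [ENNReal.toReal_ofReal (Real.exp_pos _).le, smul_eq_mul] using h
  -- This multiplier makes `J A = 0`, that is, stopping and continuing cost the same at the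
  -- threshold.
  set lam : ℝ := Real.exp A * D A / N A with hlam
  have hlam0 : 0 ≤ lam := by
    have := hN1 A
    have := hD1 A
    positivity
  set J : ℝ → ℝ := fun u => Real.exp u * D u - lam * N u with hJdef
  have hJm : Measurable J := by fun_prop
  have hJA : J A = 0 := by
    have := hN1 A
    simp only [hJdef, hlam]
    field_simp
    ring
  have hJK : ∀ u < A, |J u| ≤ Real.exp A * D 0 + lam * N 0 := by
    intro u hu
    have h1 : 0 ≤ Real.exp u * D u := mul_nonneg (Real.exp_pos _).le (by linarith [hD1 u])
    have h2 : 0 ≤ lam * N u := mul_nonneg hlam0 (by linarith [hN1 u])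
    have h3 : Real.exp u * D u ≤ Real.exp A * D 0 :=
      mul_le_mul (Real.exp_le_exp.2 hu.le) (hD0 u) (by linarith [hD1 u]) (Real.exp_pos _).le
    have h4 : lam * N u ≤ lam * N 0 := mul_le_mul_of_nonneg_left (hN0 u) hlam0
    rw [abs_le]
    constructor <;> simp only [hJdef] <;> linarith
  -- The running cost exp W - D(0) g - λ as a function of the statistic `u` before reflection.
  set c : ℝ → ℝ := fun u => Real.exp (max u 0) - D 0 * max 0 (1 - Real.exp u) - lam with hcdef
  have hc : Monotone c := by
    intro s t hst
    have h1 : Real.exp (max s 0) ≤ Real.exp (max t 0) :=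
      Real.exp_le_exp.2 (max_le_max_right 0 hst)
    have h2 : max 0 (1 - Real.exp t) ≤ max 0 (1 - Real.exp s) :=
      max_le_max_left 0 (by linarith [Real.exp_le_exp.2 hst])
    have h3 := mul_le_mul_of_nonneg_left h2 (show 0 ≤ D 0 by linarith [hD1 0])
    simp only [hcdef]
    linarith
  have hJeq : ∀ u, J u = c u + ∫ v, (if max u 0 + ℓ v < A then J (max u 0 + ℓ v) else 0) ∂μ := by
    intro u
    have h1 : ∫ v, (if max u 0 + ℓ v < A then J (max u 0 + ℓ v) else 0) ∂μ =
        ∫ v, (Real.exp (max u 0) * (Real.exp (ℓ v) *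
          (if max u 0 + ℓ v < A then D (max u 0 + ℓ v) else 0)) -
          lam * (if max u 0 + ℓ v < A then N (max u 0 + ℓ v) else 0)) ∂μ := by
      refine integral_congr_ae (Filter.Eventually.of_forall fun v => ?_)
      dsimp only
      split_ifs
      · simp only [hJdef, Real.exp_add]; ring
      · simp
    rw [h1, integral_sub ((hDint u).const_mul _) ((integrable_ite hℓ hNm hNabs _).const_mul _),
      integral_const_mul, integral_const_mul]
    have h2 := hDeq u
    have h3 := hNeq u
    -- For `u ≤ 0` reflection gives `D u = D 0`, and the reflection cost accounts exactly for the
    -- difference between `exp u` and 1.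
    have h4 : Real.exp (max u 0) * D u - D 0 * max 0 (1 - Real.exp u) = Real.exp u * D u := by
      rcases le_total u 0 with h | h
      · have : D u = D 0 := by rw [← hDmax u, max_eq_right h]
        rw [max_eq_right h, this, Real.exp_zero, max_eq_right]
        · ring
        · linarith [Real.exp_le_one_iff.2 h]
      · rw [max_eq_left h, max_eq_left]
        · ring
        · linarith [Real.one_le_exp h]
    simp only [hJdef, hcdef]
    set I₁ := ∫ v, Real.exp (ℓ v) * (if max u 0 + ℓ v < A then D (max u 0 + ℓ v) else 0) ∂μ
    set I₂ := ∫ v, (if max u 0 + ℓ v < A then N (max u 0 + ℓ v) else 0) ∂μ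
    rw [← h4, h3]
    conv_lhs => rw [h2]
    ring
  have hmono : Monotone J := monotone_of_eq_integral hℓ hN hc hJm hJK hJeq hJA
  -- As `J` is monotone and vanishes at `A`, this is the negative part of `J`: the gain from
  -- continuing optimally.
  set V : ℝ → ℝ := fun u => if u < A then -J u else 0 with hVdef
  have hVm : Measurable V := Measurable.ite measurableSet_Iio hJm.neg measurable_const
  have hV0 : ∀ u, 0 ≤ V u := by
    intro u
    simp only [hVdef]
    split_ifs with h
    · linarith [hmono h.le]
    · exact le_rfl
  have hVint : ∀ w, Integrable (fun v => V (w + ℓ v)) μ := fun w => by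
    have h := (integrable_ite (μ := μ) hℓ hJm hJK w).neg
    refine h.congr (Filter.Eventually.of_forall fun v => ?_)
    simp only [hVdef, Pi.neg_apply]
    split_ifs <;> simp
  have hVI : ∀ u, ∫ v, V (max u 0 + ℓ v) ∂μ = c u - J u := by
    intro u
    rw [hJeq u, sub_add_cancel_left, ← integral_neg]
    refine integral_congr_ae (Filter.Eventually.of_forall fun v => ?_)
    simp only [hVdef]
    split_ifs <;> simp
  have hlint : ∀ w, ∫⁻ v, ENNReal.ofReal (V (w + ℓ v)) ∂μ =
      ENNReal.ofReal (∫ v, V (w + ℓ v) ∂μ) := fun w =>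
    (ofReal_integral_eq_lintegral_ofReal (hVint w)
      (Filter.Eventually.of_forall fun v => hV0 _)).symm
  have hVI0 : ∀ w, 0 ≤ ∫ v, V (w + ℓ v) ∂μ := fun w => integral_nonneg fun v => hV0 _
  have hDr : runLength μ₁ ℓ A 0 = ENNReal.ofReal (D 0) := (ENNReal.ofReal_toReal hD).symm
  have hNr : runLength μ ℓ A 0 = ENNReal.ofReal (N 0) := (ENNReal.ofReal_toReal hN).symm
  have hD00 : 0 ≤ D 0 := by linarith [hD1 0]
  have hN00 : 0 ≤ N 0 := by linarith [hN1 0]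
  refine ⟨ENNReal.ofReal lam, fun u => ENNReal.ofReal (V u), ENNReal.ofReal_ne_top,
    hVm.ennreal_ofReal, fun u => ?_, ?_⟩
  · have hg : ENNReal.ofReal (1 - Real.exp u) = ENNReal.ofReal (max 0 (1 - Real.exp u)) := by
      rw [ENNReal.ofReal_max]; simp
    rw [hlint, hDr, hg, ← ENNReal.ofReal_mul hD00, ← ENNReal.ofReal_add (by positivity) hlam0,
      ← ENNReal.ofReal_add (by positivity) (hVI0 _),
      ← ENNReal.ofReal_add (Real.exp_pos _).le (hV0 _)]
    refine ENNReal.ofReal_le_ofReal ?_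
    rw [hVI u]
    -- Below `A` the optimality relation is an equality; above it the slack is `J u ≥ 0`.
    by_cases h : u < A
    · simp only [hcdef, hVdef, if_pos h]; linarith
    · have := hmono (not_lt.1 h)
      simp only [hcdef, hVdef, if_neg h]; linarith
  · have h := hlint 0
    simp only [zero_add] at h
    have h2 := hVI 0
    have h3 := hVI0 0
    simp only [max_self, zero_add] at h2 h3
    rw [h, hDr, hNr, ← ENNReal.ofReal_mul hlam0, ← ENNReal.ofReal_one,
      ← ENNReal.ofReal_add hD00 hlam0, ← ENNReal.ofReal_add (by positivity) h3,
      ← ENNReal.ofReal_add zero_le_one (by positivity)]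
    refine ENNReal.ofReal_le_ofReal ?_
    rw [h2]
    simp only [hcdef, hJdef, max_self, Real.exp_zero, sub_self]
    linarith

end RunLength

/-! ### The lower bound for arbitrary stopping times -/

section LowerBound

/-- The part of the likelihood ratio statistic `e ^ W_m` that is due to a reflection at time `m`. -/
noncomputable def reflection (f₁ f₀ : ℝ → ℝ) (x : ℕ → ℝ) : ℕ → ℝ≥0∞
  | 0 => 1
  | m + 1 => ENNReal.ofReal (1 - Real.exp (cusum f₁ f₀ x m + llr f₁ f₀ (x m)))

variable {f₁ f₀ : ℝ → ℝ}

lemma measurable_reflection (hℓ : Measurable (llr f₁ f₀)) (m : ℕ) :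
    Measurable fun x => reflection f₁ f₀ x m := by
  cases m with
  | zero => exact measurable_const
  | succ m =>
    have := measurable_cusum hℓ m
    have := hℓ.comp (measurable_pi_apply (X := fun _ : ℕ => ℝ) m)
    simp only [reflection]
    fun_prop

lemma dependsOn_reflection (m : ℕ) : DependsOn (fun x => reflection f₁ f₀ x m) (Iio m) := by
  cases m with
  | zero => exact fun _ _ _ => rfl
  | succ m =>
    intro x y hxy
    have h1 : cusum f₁ f₀ x m = cusum f₁ f₀ y m :=
      dependsOn_cusum m fun i hi => hxy i (lt_trans hi (Nat.lt_succ_self m))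
    simp only [reflection, h1, hxy m (Nat.lt_succ_self m)]

lemma reflection_le_one (x : ℕ → ℝ) (m : ℕ) : reflection f₁ f₀ x m ≤ 1 := by
  cases m with
  | zero => exact le_rfl
  | succ m =>
    refine ENNReal.ofReal_le_one.2 ?_
    linarith [Real.exp_pos (cusum f₁ f₀ x m + llr f₁ f₀ (x m))]

/-- With z the statistic before reflection: if z ≥ 0 the first term vanishes, and if z ≤ 0 the
identity reads 1 = (1 - exp z) + exp z. -/
lemma exp_cusum_succ (x : ℕ → ℝ) (m : ℕ) :
    ENNReal.ofReal (Real.exp (cusum f₁ f₀ x (m + 1))) = reflection f₁ f₀ x (m + 1) +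
      ENNReal.ofReal (Real.exp (llr f₁ f₀ (x m))) *
        ENNReal.ofReal (Real.exp (cusum f₁ f₀ x m)) := by
  simp only [cusum, reflection]
  set z := cusum f₁ f₀ x m + llr f₁ f₀ (x m) with hz
  rw [← ENNReal.ofReal_mul (Real.exp_pos _).le, ← Real.exp_add, add_comm (llr f₁ f₀ (x m)), ← hz]
  rcases le_total 0 z with h | h
  · rw [max_eq_right h, ENNReal.ofReal_of_nonpos (sub_nonpos.2 (Real.one_le_exp h)), zero_add]
  · rw [max_eq_left h, ← ENNReal.ofReal_add (by linarith [Real.exp_le_one_iff.2 h])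
      (Real.exp_pos _).le, sub_add_cancel, Real.exp_zero]

variable {ref : Measure ℝ} [IsProbabilityMeasure (law ref f₀)]

/-- Decomposition of `E_∞[e ^ W_m h]` according to the time of the last reflection. -/
lemma sum_lintegral_reflection [IsProbabilityMeasure (law ref f₁)] (hℓ : Measurable (llr f₁ f₀))
    (hlaw : law ref f₁ = (law ref f₀).withDensity fun v => ENNReal.ofReal (Real.exp (llr f₁ f₀ v)))
    (m : ℕ) {h : (ℕ → ℝ) → ℝ≥0∞} (hm : Measurable h) (hd : DependsOn h (Iio m)) :
    ∑ ν ∈ Finset.range (m + 1),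
      ∫⁻ x, reflection f₁ f₀ x ν * h x ∂changeLaw ref f₀ (fun _ _ => f₁) (ν + 1) =
    ∫⁻ x, ENNReal.ofReal (Real.exp (cusum f₁ f₀ x m)) * h x ∂noChangeLaw ref f₀ := by
  have hpr : ∀ ν k : ℕ, IsProbabilityMeasure (law ref (if k + 1 < ν + 1 then f₀ else f₁)) := by
    intro ν k
    split_ifs <;> infer_instance
  have hexp : Measurable fun v => ENNReal.ofReal (Real.exp (llr f₁ f₀ v)) := by fun_prop
  -- The integrand uses only the first `ν` observations, all made before a change at time `ν + 1`.
  have hlast : ∀ ν : ℕ, ∀ h : (ℕ → ℝ) → ℝ≥0∞, Measurable h → DependsOn h (Iio ν) →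
      ∫⁻ x, reflection f₁ f₀ x ν * h x ∂changeLaw ref f₀ (fun _ _ => f₁) (ν + 1) =
      ∫⁻ x, reflection f₁ f₀ x ν * h x ∂noChangeLaw ref f₀ := by
    intro ν h hm hd
    refine lintegral_infinitePi_congr (m := ν) (fun i hi => by rw [if_pos (by omega)])
      ((measurable_reflection hℓ ν).fun_mul hm) fun x y hxy => ?_
    have h1 : reflection f₁ f₀ x ν = reflection f₁ f₀ y ν := dependsOn_reflection ν hxy
    rw [h1, hd hxy]
  induction m generalizing h with
  | zero =>
    rw [zero_add, Finset.sum_range_one, hlast 0 h hm hd]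
    simp [reflection, cusum]
  | succ m ih =>
    -- For change points `ν + 1 ≤ m + 1` the observation at time `m + 1` has density `f₁`. Averaging
    -- over it reduces these terms to the induction hypothesis.
    set h' : (ℕ → ℝ) → ℝ≥0∞ := fun x => ∫⁻ v, h (Function.update x m v) ∂law ref f₁ with hh'
    have hm' : Measurable h' := measurable_lintegral_update _ m hm
    have hd' : DependsOn h' (Iio m) := dependsOn_lintegral_update _ m hd
    have hup' : ∀ x : ℕ → ℝ, Measurable fun v : ℝ => Function.update x m v := fun x =>
      measurable_update (X := fun _ : ℕ => ℝ) x
    have hhu : ∀ x : ℕ → ℝ, Measurable fun v : ℝ => h (Function.update x m v) := fun x =>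
      hm.comp (hup' x)
    have hstep : ∀ ν ∈ Finset.range (m + 1),
        ∫⁻ x, reflection f₁ f₀ x ν * h x ∂changeLaw ref f₀ (fun _ _ => f₁) (ν + 1) =
        ∫⁻ x, reflection f₁ f₀ x ν * h' x ∂changeLaw ref f₀ (fun _ _ => f₁) (ν + 1) := by
      intro ν hν
      rw [Finset.mem_range] at hν
      unfold changeLaw
      rw [lintegral_infinitePi_update _ m ((measurable_reflection hℓ ν).fun_mul hm),
        if_neg (by omega)]
      refine lintegral_congr fun x => ?_
      rw [hh', ← lintegral_const_mul _ (hhu x)]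
      refine lintegral_congr fun v => ?_
      have : reflection f₁ f₀ (Function.update x m v) ν = reflection f₁ f₀ x ν :=
        dependsOn_reflection ν fun i hi => Function.update_of_ne (by
          simp only [mem_Iio] at hi; omega) _ _
      rw [this]
    rw [Finset.sum_range_succ, Finset.sum_congr rfl hstep, ih hm' hd', hlast (m + 1) h hm hd]
    have hY : Measurable fun x => ENNReal.ofReal (Real.exp (cusum f₁ f₀ x m)) := by
      have := measurable_cusum hℓ m
      fun_prop
    have hxm : Measurable fun x : ℕ → ℝ => ENNReal.ofReal (Real.exp (llr f₁ f₀ (x m))) :=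
      hexp.comp (measurable_pi_apply m)
    -- The average over `f₁` is written as an average over `f₀` weighted by the likelihood ratio;
    -- with the new reflection term this rebuilds exp W_{m+1}.
    have hmid : ∫⁻ x, ENNReal.ofReal (Real.exp (cusum f₁ f₀ x m)) * h' x ∂noChangeLaw ref f₀ =
        ∫⁻ x, ENNReal.ofReal (Real.exp (llr f₁ f₀ (x m))) *
          ENNReal.ofReal (Real.exp (cusum f₁ f₀ x m)) * h x ∂noChangeLaw ref f₀ := by
      unfold noChangeLaw
      rw [lintegral_infinitePi_update (fun _ => law ref f₀) m ((hxm.fun_mul hY).fun_mul hm)]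
      refine lintegral_congr fun x => ?_
      rw [hh', hlaw]
      simp only
      rw [lintegral_withDensity_eq_lintegral_mul _ hexp (hhu x),
        ← lintegral_const_mul _ (hexp.mul (hhu x))]
      refine lintegral_congr fun v => ?_
      have : cusum f₁ f₀ (Function.update x m v) m = cusum f₁ f₀ x m :=
        dependsOn_cusum m fun i hi => Function.update_of_ne (ne_of_lt hi) _ _
      rw [this, Function.update_self]
      simp only [Pi.mul_apply]
      ring
    rw [hmid, ← lintegral_add_left ((hxm.fun_mul hY).fun_mul hm)]
    refine lintegral_congr fun x => ?_
    rw [exp_cusum_succ]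
    ring

/-- A stopping time whose worst-case delay under the least favorable law is `w` satisfies
`E_∞[∑_{m < σ} e ^ W_m] ≤ w E_∞[∑_{m < σ} reflection m]`. -/
lemma sum_lintegral_exp_cusum_le [IsProbabilityMeasure (law ref f₁)] (hℓ : Measurable (llr f₁ f₀))
    (hlaw : law ref f₁ = (law ref f₀).withDensity fun v => ENNReal.ofReal (Real.exp (llr f₁ f₀ v)))
    {σ : (ℕ → ℝ) → ℕ∞} (hσ : IsStoppingTime obsFiltration σ) (n : ℕ) :
    ∑ m ∈ Finset.range n, ∫⁻ x, ENNReal.ofReal (Real.exp (cusum f₁ f₀ x m)) *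
        (if (m : ℕ∞) < σ x then 1 else 0) ∂noChangeLaw ref f₀ ≤
      WADD ref f₀ (fun _ _ => f₁) σ * ∑ m ∈ Finset.range n,
        ∫⁻ x, reflection f₁ f₀ x m * (if (m : ℕ∞) < σ x then 1 else 0) ∂noChangeLaw ref f₀ := by
  have hpr : ∀ j, IsProbabilityMeasure (changeLaw ref f₀ (fun _ _ => f₁) (j + 1)) :=
    isProbabilityMeasure_changeLaw fun _ _ _ _ => inferInstance
  have hpr' : ∀ ν k : ℕ, IsProbabilityMeasure (law ref (if k + 1 < ν + 1 then f₀ else f₁)) := by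
    intro ν k
    split_ifs <;> infer_instance
  have hI := measurable_ite_lt hσ
  rw [Finset.sum_congr rfl fun m _ =>
    (sum_lintegral_reflection hℓ hlaw m (hI m) (dependsOn_ite_lt hσ m)).symm]
  -- Interchanging the sums collects, for each change point, the times `m ≥ ν` at which the test is
  -- still running.
  rw [Finset.sum_comm' (t' := Finset.range n) (s' := fun ν => Finset.Ico ν n) (by
    intro a b
    simp only [Finset.mem_range, Finset.mem_Ico]
    omega), Finset.mul_sum]
  refine Finset.sum_le_sum fun ν _ => ?_
  have hgd : DependsOn (fun x => reflection f₁ f₀ x ν * (if (ν : ℕ∞) < σ x then (1 : ℝ≥0∞) else 0))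
      (Iio ν) := by
    intro x y hxy
    have h1 : reflection f₁ f₀ x ν = reflection f₁ f₀ y ν := dependsOn_reflection ν hxy
    have h2 := dependsOn_ite_lt hσ ν hxy
    simp only at h2
    simp only [h1, h2]
  have hgm := (measurable_reflection hℓ ν).fun_mul (hI ν)
  rw [← lintegral_finsetSum _ fun m _ => (measurable_reflection hℓ ν).fun_mul (hI m)]
  calc ∫⁻ x, ∑ m ∈ Finset.Ico ν n, reflection f₁ f₀ x ν * (if (m : ℕ∞) < σ x then 1 else 0)
        ∂changeLaw ref f₀ (fun _ _ => f₁) (ν + 1)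
      ≤ ∫⁻ x, reflection f₁ f₀ x ν * (if (ν : ℕ∞) < σ x then 1 else 0) * delay σ (ν + 1) x
        ∂changeLaw ref f₀ (fun _ _ => f₁) (ν + 1) := by
        refine lintegral_mono fun x => ?_
        rw [← Finset.mul_sum, mul_assoc, delay_succ, Finset.sum_Ico_eq_sum_range]
        gcongr
        -- The factor `1{ν < σ}` costs nothing, since the sum vanishes off this event. It must
        -- appear in the weight, because the bound is summed over `ν < σ` only.
        by_cases h : (ν : ℕ∞) < σ x
        · rw [if_pos h, one_mul]
          exact ENNReal.sum_le_tsum _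
        · rw [Finset.sum_eq_zero]
          · exact zero_le
          · intro k _
            refine if_neg fun h' => h (lt_of_le_of_lt ?_ h')
            exact_mod_cast Nat.le_add_right ν k
    _ ≤ WADD ref f₀ (fun _ _ => f₁) σ *
        ∫⁻ x, reflection f₁ f₀ x ν * (if (ν : ℕ∞) < σ x then 1 else 0)
          ∂changeLaw ref f₀ (fun _ _ => f₁) (ν + 1) :=
        lintegral_mul_delay_le_WADD ref f₀ _ hσ ν hgm hgd
    _ = _ := by
        congr 1
        exact lintegral_infinitePi_congr (m := ν) (fun i hi => by rw [if_pos (by omega)]) hgm hgd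

/-- Verification argument: the last term on the left is the expected potential after one more
observation. `hstart` sets up this budget and `hstep` preserves it at each time the test is still
running, so the inequality telescopes. -/
lemma sum_lintegral_reflection_add_le (hℓ : Measurable (llr f₁ f₀)) {σ : (ℕ → ℝ) → ℕ∞}
    (hσ : IsStoppingTime obsFiltration σ) (hσ1 : ∀ x, 1 ≤ σ x) {d lam N : ℝ≥0∞} {V : ℝ → ℝ≥0∞}
    (hV : Measurable V)
    (hstep : ∀ u, d * ENNReal.ofReal (1 - Real.exp u) + lam +
      ∫⁻ v, V (max u 0 + llr f₁ f₀ v) ∂law ref f₀ ≤ ENNReal.ofReal (Real.exp (max u 0)) + V u)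
    (hstart : d + lam + ∫⁻ v, V (llr f₁ f₀ v) ∂law ref f₀ ≤ 1 + lam * N) (n : ℕ) :
    d * ∑ m ∈ Finset.range (n + 1),
        ∫⁻ x, reflection f₁ f₀ x m * (if (m : ℕ∞) < σ x then 1 else 0) ∂noChangeLaw ref f₀ +
      lam * ∑ m ∈ Finset.range (n + 1),
        ∫⁻ x, (if (m : ℕ∞) < σ x then 1 else 0) ∂noChangeLaw ref f₀ +
      ∫⁻ x, (if (n : ℕ∞) < σ x then 1 else 0) *
        ∫⁻ v, V (cusum f₁ f₀ x n + llr f₁ f₀ v) ∂law ref f₀ ∂noChangeLaw ref f₀ ≤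
    ∑ m ∈ Finset.range (n + 1), ∫⁻ x, ENNReal.ofReal (Real.exp (cusum f₁ f₀ x m)) *
        (if (m : ℕ∞) < σ x then 1 else 0) ∂noChangeLaw ref f₀ + lam * N := by
  have hI := measurable_ite_lt hσ
  have hP : IsProbabilityMeasure (noChangeLaw ref f₀) := by unfold noChangeLaw; infer_instance
  induction n with
  | zero =>
    have h0 : ∀ x, ((0 : ℕ) : ℕ∞) < σ x := fun x => lt_of_lt_of_le (by norm_num) (hσ1 x)
    simp only [zero_add, Finset.sum_range_one, h0, if_true, reflection, cusum, mul_one,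
      Real.exp_zero, ENNReal.ofReal_one, lintegral_const, measure_univ, one_mul]
    exact hstart
  | succ n ih =>
    have hUm : Measurable fun x : ℕ → ℝ => cusum f₁ f₀ x n + llr f₁ f₀ (x n) :=
      (measurable_cusum hℓ n).add (hℓ.comp (measurable_pi_apply n))
    -- Having stopped by time `n + 1` only discards nonnegative potential. The event `{n < σ}` does
    -- not involve the observation `x n`, which can thus be integrated out.
    have hpeel : ∫⁻ x, (if ((n + 1 : ℕ) : ℕ∞) < σ x then 1 else 0) *
        V (cusum f₁ f₀ x n + llr f₁ f₀ (x n)) ∂noChangeLaw ref f₀ ≤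
        ∫⁻ x, (if (n : ℕ∞) < σ x then 1 else 0) *
        ∫⁻ v, V (cusum f₁ f₀ x n + llr f₁ f₀ v) ∂law ref f₀ ∂noChangeLaw ref f₀ := by
      calc _ ≤ ∫⁻ x, (if (n : ℕ∞) < σ x then 1 else 0) *
            V (cusum f₁ f₀ x n + llr f₁ f₀ (x n)) ∂noChangeLaw ref f₀ := by
            refine lintegral_mono fun x => ?_
            gcongr
            by_cases h : ((n + 1 : ℕ) : ℕ∞) < σ x
            · have h' : (n : ℕ∞) < σ x := lt_of_le_of_lt (by exact_mod_cast Nat.le_succ n) h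
              rw [if_pos h, if_pos h']
            · rw [if_neg h]; exact zero_le
        _ = _ := by
            unfold noChangeLaw
            rw [lintegral_infinitePi_update (fun _ => law ref f₀) n ((hI n).fun_mul (hV.fun_comp hUm))]
            refine lintegral_congr fun x => ?_
            rw [← lintegral_const_mul _ (by fun_prop)]
            refine lintegral_congr fun v => ?_
            have hag : ∀ i ∈ Iio n, Function.update x n v i = x i := fun i hi =>
              Function.update_of_ne (ne_of_lt hi) _ _
            have h1 : cusum f₁ f₀ (Function.update x n v) n = cusum f₁ f₀ x n :=
              dependsOn_cusum n hag
            have h2 := dependsOn_ite_lt hσ n hag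
            simp only at h2
            rw [h1, h2, Function.update_self]
    have hmg : Measurable fun x => reflection f₁ f₀ x (n + 1) *
        (if ((n + 1 : ℕ) : ℕ∞) < σ x then (1 : ℝ≥0∞) else 0) :=
      (measurable_reflection hℓ (n + 1)).mul (hI (n + 1))
    have hmY : Measurable fun x => ENNReal.ofReal (Real.exp (cusum f₁ f₀ x (n + 1))) *
        (if ((n + 1 : ℕ) : ℕ∞) < σ x then (1 : ℝ≥0∞) else 0) := by
      have := measurable_cusum hℓ (n + 1)
      exact Measurable.mul (by fun_prop) (hI (n + 1))
    have hpt : d * ∫⁻ x, reflection f₁ f₀ x (n + 1) *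
          (if ((n + 1 : ℕ) : ℕ∞) < σ x then 1 else 0) ∂noChangeLaw ref f₀ +
        lam * ∫⁻ x, (if ((n + 1 : ℕ) : ℕ∞) < σ x then 1 else 0) ∂noChangeLaw ref f₀ +
        ∫⁻ x, (if ((n + 1 : ℕ) : ℕ∞) < σ x then 1 else 0) *
          ∫⁻ v, V (cusum f₁ f₀ x (n + 1) + llr f₁ f₀ v) ∂law ref f₀ ∂noChangeLaw ref f₀ ≤
        ∫⁻ x, ENNReal.ofReal (Real.exp (cusum f₁ f₀ x (n + 1))) *
          (if ((n + 1 : ℕ) : ℕ∞) < σ x then 1 else 0) ∂noChangeLaw ref f₀ +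
        ∫⁻ x, (if ((n + 1 : ℕ) : ℕ∞) < σ x then 1 else 0) *
          V (cusum f₁ f₀ x n + llr f₁ f₀ (x n)) ∂noChangeLaw ref f₀ := by
      rw [← lintegral_const_mul _ hmg, ← lintegral_const_mul _ (hI (n + 1)),
        ← lintegral_add_left (hmg.const_mul d),
        ← lintegral_add_left ((hmg.const_mul d).fun_add ((hI (n + 1)).const_mul lam)),
        ← lintegral_add_left hmY]
      refine lintegral_mono fun x => ?_
      by_cases h : ((n + 1 : ℕ) : ℕ∞) < σ x
      -- The potential inequality is used at the statistic before reflection, which determines both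
      -- the reflection term and `W_{n+1}`.
      · have := hstep (cusum f₁ f₀ x n + llr f₁ f₀ (x n))
        rw [max_comm] at this
        simpa only [if_pos h, mul_one, one_mul, reflection, cusum] using this
      · simp only [if_neg h, mul_zero, zero_mul, add_zero, le_refl]
    rw [Finset.sum_range_succ _ (n + 1), Finset.sum_range_succ _ (n + 1),
      Finset.sum_range_succ _ (n + 1)]
    set S₁ := ∑ m ∈ Finset.range (n + 1),
      ∫⁻ x, reflection f₁ f₀ x m * (if (m : ℕ∞) < σ x then 1 else 0) ∂noChangeLaw ref f₀
    set S₂ := ∑ m ∈ Finset.range (n + 1),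
      ∫⁻ x, (if (m : ℕ∞) < σ x then 1 else 0) ∂noChangeLaw ref f₀
    set Q := ∫⁻ x, (if (n : ℕ∞) < σ x then 1 else 0) *
      ∫⁻ v, V (cusum f₁ f₀ x n + llr f₁ f₀ v) ∂law ref f₀ ∂noChangeLaw ref f₀
    set Y := ∫⁻ x, ENNReal.ofReal (Real.exp (cusum f₁ f₀ x (n + 1))) *
      (if ((n + 1 : ℕ) : ℕ∞) < σ x then 1 else 0) ∂noChangeLaw ref f₀
    have h1 := add_le_add_right (hpt.trans (add_le_add_right hpeel _)) (d * S₁ + lam * S₂)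
    have h2 := add_le_add_left ih Y
    refine le_trans (le_of_eq ?_) (h1.trans (le_trans (le_of_eq ?_) (h2.trans (le_of_eq ?_))))
    · ring
    · rw [add_comm Y Q, ← add_assoc]
    · rw [add_right_comm]

/-- Among all stopping times whose mean time to a false alarm is at least that of the CUSUM test,
none has a smaller worst-case delay under the least favorable law. -/
lemma runLength_le_WADD [IsProbabilityMeasure (law ref f₁)] (hℓ : Measurable (llr f₁ f₀))
    (hlaw : law ref f₁ = (law ref f₀).withDensity fun v => ENNReal.ofReal (Real.exp (llr f₁ f₀ v)))
    {A : ℝ} (hN : runLength (law ref f₀) (llr f₁ f₀) A 0 ≠ ⊤)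
    (hD : runLength (law ref f₁) (llr f₁ f₀) A 0 ≠ ⊤)
    {σ : (ℕ → ℝ) → ℕ∞} (hσ : IsStoppingTime obsFiltration σ) (hσ1 : ∀ x, 1 ≤ σ x)
    (hMFA : runLength (law ref f₀) (llr f₁ f₀) A 0 ≤ MFA ref f₀ σ) :
    runLength (law ref f₁) (llr f₁ f₀) A 0 ≤ WADD ref f₀ (fun _ _ => f₁) σ := by
  obtain ⟨lam, V, hlam, hV, hstep, hstart⟩ := exists_potential hℓ hlaw hN hD
  set d := runLength (law ref f₁) (llr f₁ f₀) A 0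
  set N := runLength (law ref f₀) (llr f₁ f₀) A 0
  set w := WADD ref f₀ (fun _ _ => f₁) σ
  have hP : IsProbabilityMeasure (noChangeLaw ref f₀) := by unfold noChangeLaw; infer_instance
  by_contra! hlt
  have hw : w ≠ ⊤ := hlt.ne_top
  -- The inequality is kept at finite horizons, where the reflection sum `R` is finite and `w * R`
  -- can be cancelled.
  have hkey : ∀ n : ℕ, (d - w) + lam * ∑ m ∈ Finset.range (n + 1),
      noChangeLaw ref f₀ {x | (m : ℕ∞) < σ x} ≤ lam * N := by
    intro n
    have h1 := sum_lintegral_reflection_add_le hℓ hσ hσ1 hV hstep hstart n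
    have h2 := sum_lintegral_exp_cusum_le hℓ hlaw hσ (n + 1)
    set R := ∑ m ∈ Finset.range (n + 1),
        ∫⁻ x, reflection f₁ f₀ x m * (if (m : ℕ∞) < σ x then 1 else 0) ∂noChangeLaw ref f₀ with hR
    have hRtop : R ≠ ⊤ := by
      refine ENNReal.sum_ne_top.2 fun m _ => ?_
      refine ne_top_of_le_ne_top ENNReal.one_ne_top ?_
      calc _ ≤ ∫⁻ _, 1 ∂noChangeLaw ref f₀ := by
            refine lintegral_mono fun x => ?_
            split_ifs
            · simpa using reflection_le_one x m
            · simp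
        _ = 1 := by simp
    -- The term at time 0 equals 1 because `σ ≥ 1`; it bounds the slack `(d - w) * R` from below
    -- uniformly in `n`.
    have hR1 : 1 ≤ R := by
      refine le_trans ?_ (Finset.single_le_sum (fun _ _ => zero_le)
        (Finset.mem_range.2 (Nat.succ_pos n)))
      have h0 : ∀ x, ((0 : ℕ) : ℕ∞) < σ x := fun x => lt_of_lt_of_le (by norm_num) (hσ1 x)
      simp only [reflection, h0, if_true, mul_one, lintegral_const, measure_univ, le_refl]
    have hT : ∀ m : ℕ, ∫⁻ x, (if (m : ℕ∞) < σ x then (1 : ℝ≥0∞) else 0) ∂noChangeLaw ref f₀ =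
        noChangeLaw ref f₀ {x | (m : ℕ∞) < σ x} := by
      intro m
      rw [← lintegral_indicator_one (obsFiltration.le m _ (measurableSet_lt_stoppingTime hσ m))]
      exact lintegral_congr fun x => by simp [indicator_apply]
    simp only [hT] at h1
    have h3 := (le_self_add.trans h1).trans (add_le_add_left h2 _)
    have h4 : d * R = w * R + (d - w) * R := by
      rw [← add_mul, add_tsub_cancel_of_le hlt.le]
    rw [h4, add_assoc] at h3
    have h5 := (ENNReal.add_le_add_iff_left (ENNReal.mul_ne_top hw hRtop)).1 h3
    refine le_trans ?_ h5
    gcongr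
    exact le_mul_of_one_le_right zero_le hR1
  have hlim : (d - w) + lam * MFA ref f₀ σ ≤ lam * N := by
    rw [MFA_eq_tsum _ _ _ fun k => obsFiltration.le k _ (measurableSet_lt_stoppingTime hσ k)]
    have ht := (ENNReal.tendsto_nat_tsum fun k : ℕ => noChangeLaw ref f₀ {x | (k : ℕ∞) < σ x}).comp
      (Filter.tendsto_add_atTop_nat 1)
    exact le_of_tendsto' ((ENNReal.Tendsto.const_mul ht (Or.inr hlam)).const_add _) hkey
  -- The constraint `N ≤ MFA` enters only here; cancelling the finite `lam * N` leaves `d - w = 0`.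
  have h6 : (d - w) + lam * N ≤ 0 + lam * N := by
    rw [zero_add]
    exact le_trans (by gcongr) hlim
  have h7 := (ENNReal.add_le_add_iff_right (ENNReal.mul_ne_top hlam hN)).1 h6
  exact absurd (tsub_eq_zero_iff_le.1 (le_antisymm h7 zero_le)) (not_le.2 hlt)

end LowerBound

/-! ### Existence of a threshold with a prescribed false alarm time -/

section Threshold

/-- From a nonnegative state, staying below `A` forces every single increment to be below `A`. -/
lemma survival_le_pow {μ : Measure ℝ} [SFinite μ] {ℓ : ℝ → ℝ} (hℓ : Measurable ℓ) (A : ℝ) (k : ℕ)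
    (u : ℝ) : survival μ ℓ A k u ≤ μ {v | ℓ v < A} ^ k := by
  induction k generalizing u with
  | zero => simp [survival]
  | succ k ih =>
    have hms : MeasurableSet {v | ℓ v < A} := measurableSet_lt hℓ measurable_const
    calc survival μ ℓ A (k + 1) u
        ≤ ∫⁻ v, {v | ℓ v < A}.indicator (fun _ => μ {v | ℓ v < A} ^ k) v ∂μ := by
          refine lintegral_mono fun v => ?_
          split_ifs with h
          · have hv : ℓ v < A := by linarith [le_max_right u 0]
            rw [indicator_of_mem (show v ∈ {v | ℓ v < A} from hv)]
            exact ih _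
          · exact zero_le
      _ = _ := by rw [lintegral_indicator_const hms, pow_succ]

variable {f₁ f₀ : ℝ → ℝ} {ref : Measure ℝ}

lemma cusumTime_mono (x : ℕ → ℝ) : Monotone fun A => cusumTime f₁ f₀ A x := fun _ _ h =>
  le_iInf₂ fun m hm => iInf₂_le m ⟨hm.1, h.trans hm.2⟩

lemma MFA_cusumTime_mono : Monotone fun A => MFA ref f₀ (cusumTime f₁ f₀ A) := fun _ _ h =>
  lintegral_mono fun x => ENat.toENNReal_mono (cusumTime_mono x h)

lemma measurable_toENNReal {τ : (ℕ → ℝ) → ℕ∞} (hτ : IsStoppingTime obsFiltration τ) :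
    Measurable fun x => (τ x : ℝ≥0∞) := by
  have h : (fun x => (τ x : ℝ≥0∞)) = delay τ (0 + 1) := by
    funext x
    rw [delay]
    push_cast
    exact (ENNReal.add_sub_cancel_right ENNReal.one_ne_top).symm
  rw [h]
  exact measurable_delay hτ 0

lemma exists_lt_cusumTime {u : ℕ → ℝ} (hu : Monotone u) {x : ℕ → ℝ} {k : ℕ}
    (h : ∀ m, 1 ≤ m → m ≤ k → ∃ n, cusum f₁ f₀ x m < u n) :
    ∃ n, (k : ℕ∞) < cusumTime f₁ f₀ (u n) x := by
  simp only [lt_cusumTime_iff]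
  induction k with
  | zero => exact ⟨0, fun m h1 h2 => by omega⟩
  | succ k ih =>
    obtain ⟨a, ha⟩ := ih fun m h1 h2 => h m h1 (by omega)
    obtain ⟨b, hb⟩ := h (k + 1) (by omega) le_rfl
    refine ⟨max a b, fun m h1 h2 => ?_⟩
    rcases Nat.lt_or_ge m (k + 1) with hm | hm
    · exact (ha m h1 (by omega)).trans_le (hu (le_max_left _ _))
    · obtain rfl : m = k + 1 := le_antisymm h2 hm
      exact hb.trans_le (hu (le_max_right _ _))

/-- Monotone convergence along increasing thresholds. It serves twice: for left-continuity in the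
threshold, and with `τ = ⊤` for divergence at infinity. -/
lemma MFA_le_iSup (hℓ : Measurable (llr f₁ f₀)) {u : ℕ → ℝ} (hu : Monotone u)
    {τ : (ℕ → ℝ) → ℕ∞} (h : ∀ x, ∀ k : ℕ, (k : ℕ∞) < τ x →
      ∀ m, 1 ≤ m → m ≤ k → ∃ n, cusum f₁ f₀ x m < u n) :
    MFA ref f₀ τ ≤ ⨆ n, MFA ref f₀ (cusumTime f₁ f₀ (u n)) := by
  unfold MFA
  rw [← lintegral_iSup (fun n => measurable_toENNReal (isStoppingTime_cusumTime hℓ))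
    fun a b hab x => ENat.toENNReal_mono (cusumTime_mono x (hu hab))]
  refine lintegral_mono fun x => ?_
  rw [← ENat.toENNReal_iSup, ENat.toENNReal_le]
  refine le_of_forall_lt fun c hc => ?_
  lift c to ℕ using hc.ne_top
  obtain ⟨n, hn⟩ := exists_lt_cusumTime hu (h x c hc)
  exact hn.trans_le (le_iSup (fun n => cusumTime f₁ f₀ (u n) x) n)

variable [IsProbabilityMeasure (law ref f₀)]

lemma MFA_cusumTime_ne_top (hℓ : Measurable (llr f₁ f₀)) {ε : ℝ} (hε : 0 < ε)
    (hμ : law ref f₀ {v | ε ≤ llr f₁ f₀ v} ≠ 0) {A : ℝ} (hA : 0 < A) :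
    MFA ref f₀ (cusumTime f₁ f₀ A) ≠ ⊤ := by
  rw [MFA_cusumTime ref hℓ hA]
  exact tsum_survival_ne_top hℓ hA hε hμ

/-- To land on `r > 0`, the increment must hit `r - W_m`. This is a null event unless `W_m = r -
r₀`; as `r₀ ≤ 0`, that value is again positive and is excluded by induction. -/
lemma noChangeLaw_cusum_eq (hℓ : Measurable (llr f₁ f₀)) {r₀ : ℝ} (hr₀ : r₀ ≤ 0)
    (hat : ∀ r, r ≠ r₀ → law ref f₀ {v | llr f₁ f₀ v = r} = 0) (m : ℕ) {r : ℝ} (hr : 0 < r) :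
    noChangeLaw ref f₀ {x | cusum f₁ f₀ x m = r} = 0 := by
  induction m generalizing r with
  | zero => simp [cusum, hr.ne]
  | succ m ih =>
    have hms : ∀ (m : ℕ) (r : ℝ), MeasurableSet {x | cusum f₁ f₀ x m = r} := fun m r =>
      measurable_cusum hℓ m (measurableSet_singleton r)
    have hzero := ih (r := r - r₀) (by linarith)
    rw [← lintegral_indicator_one (hms _ _)]
    unfold noChangeLaw at hzero ⊢
    rw [lintegral_infinitePi_update _ m (measurable_one.indicator (hms _ _)),
      lintegral_eq_zero_iff (measurable_lintegral_update _ m (measurable_one.indicator (hms _ _)))]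
    have hae := compl_mem_ae_iff.2 hzero
    filter_upwards [hae] with x hx
    have hx' : r - cusum f₁ f₀ x m ≠ r₀ := fun h => hx (by
      show cusum f₁ f₀ x m = r - r₀
      linarith)
    refine le_antisymm ?_ zero_le
    refine le_trans ?_ (hat _ hx').le
    have hE : MeasurableSet {v | llr f₁ f₀ v = r - cusum f₁ f₀ x m} :=
      hℓ (measurableSet_singleton _)
    rw [← lintegral_indicator_one hE]
    refine lintegral_mono fun v => ?_
    by_cases hv : Function.update x m v ∈ {x | cusum f₁ f₀ x (m + 1) = r}
    · have h1 : cusum f₁ f₀ (Function.update x m v) m = cusum f₁ f₀ x m :=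
        dependsOn_cusum m fun i hi => Function.update_of_ne (ne_of_lt hi) _ _
      have h2 : max 0 (cusum f₁ f₀ x m + llr f₁ f₀ v) = r := by
        have : cusum f₁ f₀ (Function.update x m v) (m + 1) = r := hv
        rwa [cusum, h1, Function.update_self] at this
      have h3 : v ∈ {v | llr f₁ f₀ v = r - cusum f₁ f₀ x m} := by
        show llr f₁ f₀ v = r - cusum f₁ f₀ x m
        rcases max_choice 0 (cusum f₁ f₀ x m + llr f₁ f₀ v) with h | h <;> linarith
      rw [indicator_of_mem hv, indicator_of_mem h3]
      rfl
    · rw [indicator_of_notMem hv]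
      exact zero_le

/-- The mean time to a false alarm of the CUSUM test takes every value above its limit at the
threshold zero. -/
lemma exists_MFA_cusumTime_eq (hℓ : Measurable (llr f₁ f₀)) {r₀ : ℝ} (hr₀ : r₀ ≤ 0)
    (hat : ∀ r, r ≠ r₀ → law ref f₀ {v | llr f₁ f₀ v = r} = 0) {ε : ℝ} (hε : 0 < ε)
    (hμ : law ref f₀ {v | ε ≤ llr f₁ f₀ v} ≠ 0) {β : ℝ}
    (hβ : 1 < β * (law ref f₀).real {v | 0 < llr f₁ f₀ v}) :
    ∃ A, 0 < A ∧ MFA ref f₀ (cusumTime f₁ f₀ A) = ENNReal.ofReal β := by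
  set F : ℝ → ℝ≥0∞ := fun A => MFA ref f₀ (cusumTime f₁ f₀ A) with hF
  have hmono : Monotone F := MFA_cusumTime_mono
  have hP : IsProbabilityMeasure (noChangeLaw ref f₀) := by unfold noChangeLaw; infer_instance
  have hβ0 : 0 < β := by
    by_contra! h
    nlinarith [measureReal_nonneg (μ := law ref f₀) (s := {v | 0 < llr f₁ f₀ v})]
  -- For small `A` the run length is at most the geometric mean 1 / P(ℓ ≥ A). The hypothesis on `β`
  -- leaves room to choose such an `A`.
  have hsmall : ∃ A, 0 < A ∧ F A ≤ ENNReal.ofReal β := by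
    have hU : {v | 0 < llr f₁ f₀ v} = ⋃ n : ℕ, {v | 1 / ((n : ℝ) + 1) ≤ llr f₁ f₀ v} := by
      ext v
      simp only [mem_iUnion]
      constructor
      · intro hv
        obtain ⟨n, hn⟩ := exists_nat_one_div_lt (show 0 < llr f₁ f₀ v from hv)
        exact ⟨n, hn.le⟩
      · rintro ⟨n, hn⟩
        exact lt_of_lt_of_le Nat.one_div_pos_of_nat (show 1 / ((n : ℝ) + 1) ≤ llr f₁ f₀ v from hn)
    have hm : Monotone fun n : ℕ => {v | 1 / ((n : ℝ) + 1) ≤ llr f₁ f₀ v} := fun a b hab v hv => by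
      have h1 : 1 / ((a : ℝ) + 1) ≤ llr f₁ f₀ v := hv
      have h2 := one_div_le_one_div_of_le (a := (a : ℝ) + 1) (b := (b : ℝ) + 1) (by positivity)
        (by exact_mod_cast Nat.succ_le_succ hab)
      exact h2.trans h1
    have hβ' : (ENNReal.ofReal β)⁻¹ < law ref f₀ {v | 0 < llr f₁ f₀ v} := by
      have hlt : β⁻¹ < (law ref f₀).real {v | 0 < llr f₁ f₀ v} := by
        rw [inv_eq_one_div, div_lt_iff₀ hβ0]
        linarith
      rw [← ENNReal.ofReal_inv_of_pos hβ0, ← ofReal_measureReal]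
      exact (ENNReal.ofReal_lt_ofReal_iff ((inv_pos.2 hβ0).trans hlt)).2 hlt
    rw [hU, hm.measure_iUnion, lt_iSup_iff] at hβ'
    obtain ⟨n, hn⟩ := hβ'
    refine ⟨1 / ((n : ℝ) + 1), Nat.one_div_pos_of_nat, ?_⟩
    have hc : law ref f₀ {v | llr f₁ f₀ v < 1 / ((n : ℝ) + 1)} =
        1 - law ref f₀ {v | 1 / ((n : ℝ) + 1) ≤ llr f₁ f₀ v} := by
      rw [← prob_compl_eq_one_sub (measurableSet_le measurable_const hℓ)]
      congr 1
      ext v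
      exact (not_le (a := 1 / ((n : ℝ) + 1)) (b := llr f₁ f₀ v)).symm
    calc F (1 / ((n : ℝ) + 1))
        = ∑' k, survival (law ref f₀) (llr f₁ f₀) (1 / ((n : ℝ) + 1)) k 0 :=
          MFA_cusumTime ref hℓ Nat.one_div_pos_of_nat
      _ ≤ ∑' k, (law ref f₀ {v | llr f₁ f₀ v < 1 / ((n : ℝ) + 1)}) ^ k :=
          ENNReal.tsum_le_tsum fun k => survival_le_pow hℓ _ k 0
      _ = (law ref f₀ {v | 1 / ((n : ℝ) + 1) ≤ llr f₁ f₀ v})⁻¹ := by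
          rw [ENNReal.tsum_geometric, hc,
            ENNReal.sub_sub_cancel ENNReal.one_ne_top prob_le_one]
      _ ≤ ENNReal.ofReal β := ENNReal.inv_le_iff_inv_le.1 hn.le
  have hlarge : ∃ A, ENNReal.ofReal β < F A := by
    have h := MFA_le_iSup (ref := ref) hℓ (u := fun n : ℕ => (n : ℝ)) Nat.mono_cast
      (τ := fun _ => ⊤) fun x k _ m _ _ => exists_nat_gt _
    have htop : MFA ref f₀ (fun _ => ⊤) = ⊤ := by simp [MFA]
    rw [htop, top_le_iff] at h
    have h2 : ENNReal.ofReal β < ⨆ n : ℕ, MFA ref f₀ (cusumTime f₁ f₀ (n : ℝ)) := by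
      rw [h]; exact ENNReal.ofReal_lt_top
    obtain ⟨n, hn⟩ := lt_iSup_iff.1 h2
    exact ⟨n, hn⟩
  -- The threshold is the supremum of those whose false alarm time does not exceed `β`; equality
  -- needs continuity from both sides.
  set S := {A | 0 < A ∧ F A ≤ ENNReal.ofReal β} with hS
  have hSne : S.Nonempty := hsmall
  have hSb : BddAbove S := by
    obtain ⟨B, hB⟩ := hlarge
    refine ⟨B, fun A hA => ?_⟩
    by_contra! h
    exact absurd (hB.trans_le (hmono h.le)) (not_lt.2 hA.2)
  set A := sSup S
  have hA : 0 < A := by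
    obtain ⟨a, ha⟩ := hsmall
    exact ha.1.trans_le (le_csSup hSb ha)
  refine ⟨A, hA, le_antisymm ?_ ?_⟩
  · have hu : Monotone fun n : ℕ => A - 1 / ((n : ℝ) + 1) := fun a b hab => by
      have := one_div_le_one_div_of_le (a := (a : ℝ) + 1) (b := (b : ℝ) + 1) (by positivity)
          (by exact_mod_cast Nat.succ_le_succ hab)
      simp only
      linarith
    refine (MFA_le_iSup (ref := ref) hℓ hu (τ := cusumTime f₁ f₀ A) fun x k hk m h1 h2 => ?_).trans
      (iSup_le fun n => ?_)
    · have := (lt_cusumTime_iff k x).1 hk m h1 h2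
      obtain ⟨n, hn⟩ := exists_nat_one_div_lt (sub_pos.2 this)
      exact ⟨n, by linarith⟩
    · obtain ⟨s, hs, hlt⟩ := exists_lt_of_lt_csSup hSne
        (show A - 1 / ((n : ℝ) + 1) < A by linarith [Nat.one_div_pos_of_nat (α := ℝ) (n := n)])
      exact (hmono hlt.le).trans hs.2
  -- Right-continuity: almost surely no `W_m` equals `A`, so a crossing of `A` also crosses some
  -- larger threshold. The finite mean at `A + 1` permits the decreasing limit under the integral.
  · have hae : ∀ᵐ x ∂noChangeLaw ref f₀, ∀ m, cusum f₁ f₀ x m ≠ A :=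
      ae_all_iff.2 fun m => compl_mem_ae_iff.2 (noChangeLaw_cusum_eq hℓ hr₀ hat m hA)
    have hanti : Antitone fun n : ℕ => A + 1 / ((n : ℝ) + 1) := fun a b hab => by
      have := one_div_le_one_div_of_le (a := (a : ℝ) + 1) (b := (b : ℝ) + 1) (by positivity)
          (by exact_mod_cast Nat.succ_le_succ hab)
      simp only
      linarith
    calc ENNReal.ofReal β ≤ ⨅ n : ℕ, F (A + 1 / ((n : ℝ) + 1)) := by
          refine le_iInf fun n => ?_
          have hpos := Nat.one_div_pos_of_nat (α := ℝ) (n := n)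
          by_contra! h
          have := le_csSup hSb (show A + 1 / ((n : ℝ) + 1) ∈ S from ⟨by linarith, h.le⟩)
          linarith
      _ = ∫⁻ x, ⨅ n : ℕ, (cusumTime f₁ f₀ (A + 1 / ((n : ℝ) + 1)) x : ℝ≥0∞)
            ∂noChangeLaw ref f₀ :=
          (lintegral_iInf (fun n => measurable_toENNReal (isStoppingTime_cusumTime hℓ))
            (fun a b hab x => ENat.toENNReal_mono (cusumTime_mono x (hanti hab)))
            (MFA_cusumTime_ne_top hℓ hε hμ (by positivity))).symm
      _ ≤ F A := by
          refine lintegral_mono_ae ?_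
          filter_upwards [hae] with x hx
          rw [← ENat.toENNReal_iInf, ENat.toENNReal_le]
          refine le_iInf₂ fun m hm => ?_
          obtain ⟨n, hn⟩ := exists_nat_one_div_lt
            (sub_pos.2 (lt_of_le_of_ne hm.2 (hx m).symm))
          exact iInf_le_of_le n (iInf₂_le m ⟨hm.1, by linarith⟩)

end Threshold

/-! ### From the two bounds to robust optimality -/

section Optimality

variable {f₁ f₀ : ℝ → ℝ} {ref : Measure ℝ}

lemma isRobustOptimal_cusumTime_of_pos [IsProbabilityMeasure (law ref f₀)]
    [IsProbabilityMeasure (law ref f₁)] (hℓ : Measurable (llr f₁ f₀))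
    (hlaw : law ref f₁ = (law ref f₀).withDensity fun v => ENNReal.ofReal (Real.exp (llr f₁ f₀ v)))
    {ε : ℝ} (hε : 0 < ε) (hμ : law ref f₀ {v | ε ≤ llr f₁ f₀ v} ≠ 0)
    {𝒢 : Set (ℕ → ℕ → ℝ → ℝ)} (hmem : (fun _ _ => f₁) ∈ 𝒢)
    (hpr : ∀ G ∈ 𝒢, ∀ m ν, 1 ≤ m → 1 ≤ ν → IsProbabilityMeasure (law ref (G m ν)))
    (hst : ∀ G ∈ 𝒢, ∀ m ν, 1 ≤ m → 1 ≤ ν →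
      StochLarger ((law ref (G m ν)).map (llr f₁ f₀)) ((law ref f₁).map (llr f₁ f₀)))
    {A β : ℝ} (hA : 0 < A) (hβ : MFA ref f₀ (cusumTime f₁ f₀ A) = ENNReal.ofReal β) :
    IsRobustOptimal ref f₀ 𝒢 β (cusumTime f₁ f₀ A) := by
  -- On this set the likelihood ratio `exp ℓ` is at least 1, so `f₁` charges it at least as much as
  -- `f₀`.
  have hμ₁ : law ref f₁ {v | ε ≤ llr f₁ f₀ v} ≠ 0 := by
    have hms : MeasurableSet {v | ε ≤ llr f₁ f₀ v} := measurableSet_le measurable_const hℓ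
    refine ne_of_gt ((pos_iff_ne_zero.2 hμ).trans_le ?_)
    rw [hlaw, withDensity_apply _ hms, ← setLIntegral_one]
    refine setLIntegral_mono' hms fun v hv => ?_
    rw [← ENNReal.ofReal_one]
    exact ENNReal.ofReal_le_ofReal (Real.one_le_exp (hε.le.trans hv))
  have hN : runLength (law ref f₀) (llr f₁ f₀) A 0 ≠ ⊤ := tsum_survival_ne_top hℓ hA hε hμ
  have hD : runLength (law ref f₁) (llr f₁ f₀) A 0 ≠ ⊤ := tsum_survival_ne_top hℓ hA hε hμ₁
  have hM : MFA ref f₀ (cusumTime f₁ f₀ A) = runLength (law ref f₀) (llr f₁ f₀) A 0 :=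
    MFA_cusumTime ref hℓ hA
  refine ⟨⟨isStoppingTime_cusumTime hℓ, one_le_cusumTime, hβ.ge⟩, fun σ hσ => ?_⟩
  calc ⨆ G ∈ 𝒢, WADD ref f₀ G (cusumTime f₁ f₀ A)
      ≤ runLength (law ref f₁) (llr f₁ f₀) A 0 :=
        iSup₂_le fun G hG => WADD_cusumTime_le ref G (hpr G hG) (hst G hG) hℓ hA
    _ ≤ WADD ref f₀ (fun _ _ => f₁) σ :=
        runLength_le_WADD hℓ hlaw hN hD hσ.1 hσ.2.1 (by rw [← hM, hβ]; exact hσ.2.2)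
    _ ≤ ⨆ G ∈ 𝒢, WADD ref f₀ G σ := le_iSup₂ (f := fun G _ => WADD ref f₀ G σ) _ hmem

lemma cusumTime_of_nonpos {A : ℝ} (hA : A ≤ 0) (x : ℕ → ℝ) : cusumTime f₁ f₀ A x = 1 :=
  le_antisymm (iInf₂_le 1 ⟨le_rfl, hA.trans (cusum_nonneg x 1)⟩) (one_le_cusumTime x)

lemma MFA_cusumTime_of_nonpos [IsProbabilityMeasure (law ref f₀)] {A : ℝ} (hA : A ≤ 0) :
    MFA ref f₀ (cusumTime f₁ f₀ A) = 1 := by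
  have hP : IsProbabilityMeasure (noChangeLaw ref f₀) := by unfold noChangeLaw; infer_instance
  simp [MFA, cusumTime_of_nonpos hA]

/-- The test stops at time 1, so its delay never exceeds 1; a change at `ν = 1` forces delay at
least 1 on every `σ ≥ 1`. -/
lemma isRobustOptimal_cusumTime_of_nonpos [IsProbabilityMeasure (law ref f₀)] (hℓ : Measurable (llr f₁ f₀))
    {𝒢 : Set (ℕ → ℕ → ℝ → ℝ)} (hmem : (fun _ _ => f₁) ∈ 𝒢)
    (hpr : ∀ G ∈ 𝒢, ∀ m ν, 1 ≤ m → 1 ≤ ν → IsProbabilityMeasure (law ref (G m ν)))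
    {A β : ℝ} (hA : A ≤ 0) (hβ : β ≤ 1) :
    IsRobustOptimal ref f₀ 𝒢 β (cusumTime f₁ f₀ A) := by
  refine ⟨⟨isStoppingTime_cusumTime hℓ, one_le_cusumTime, ?_⟩, fun σ hσ => ?_⟩
  · rw [MFA_cusumTime_of_nonpos hA]
    exact ENNReal.ofReal_le_one.2 hβ
  calc ⨆ G ∈ 𝒢, WADD ref f₀ G (cusumTime f₁ f₀ A) ≤ 1 := by
        refine iSup₂_le fun G hG => ?_
        have := isProbabilityMeasure_changeLaw (ref := ref) (f₀ := f₀) (hpr G hG)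
        refine WADD_le ref f₀ G _ fun j B _ => ?_
        rw [← setLIntegral_const]
        refine lintegral_mono fun x => ?_
        rw [delay, cusumTime_of_nonpos hA]
        push_cast
        exact tsub_le_iff_right.2 (by gcongr; exact le_add_self)
    _ ≤ WADD ref f₀ (fun _ _ => f₁) σ := by
        have := isProbabilityMeasure_changeLaw (ref := ref) (f₀ := f₀) (hpr _ hmem)
        have h := lintegral_mul_delay_le_WADD ref f₀ (fun _ _ => f₁) hσ.1 0
          (g := fun _ => 1) measurable_const fun _ _ _ => rfl
        rw [lintegral_one, measure_univ, mul_one] at h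
        refine le_trans ?_ h
        calc (1 : ℝ≥0∞) = ∫⁻ _, 1 ∂changeLaw ref f₀ (fun _ _ => f₁) (0 + 1) := by simp
          _ ≤ _ := by
            refine lintegral_mono fun x => ?_
            rw [one_mul, delay]
            push_cast
            rw [ENNReal.add_sub_cancel_right ENNReal.one_ne_top]
            exact_mod_cast hσ.2.1 x
    _ ≤ ⨆ G ∈ 𝒢, WADD ref f₀ G σ := le_iSup₂ (f := fun G _ => WADD ref f₀ G σ) _ hmem

/-- Single crossing of two probability densities: for `c ≥ 1` compare them on `E`, for `c ≤ 1` on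
the complement. -/
lemma law_le_law_of_le {f g : ℝ → ℝ} [IsProbabilityMeasure (law ref f)]
    [IsProbabilityMeasure (law ref g)] (hf : ∀ v, 0 ≤ f v) {E : Set ℝ} (hE : MeasurableSet E)
    {c : ℝ} (h1 : ∀ v ∈ E, c * f v ≤ g v) (h2 : ∀ v ∉ E, g v ≤ c * f v) :
    law ref f E ≤ law ref g E := by
  rcases le_total 1 c with hc | hc
  · rw [law, law, withDensity_apply _ hE, withDensity_apply _ hE]
    refine setLIntegral_mono' hE fun v hv => ENNReal.ofReal_le_ofReal ?_
    nlinarith [hf v, h1 v hv]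
  · have h : law ref g Eᶜ ≤ law ref f Eᶜ := by
      rw [law, law, withDensity_apply _ hE.compl, withDensity_apply _ hE.compl]
      refine setLIntegral_mono' hE.compl fun v hv => ENNReal.ofReal_le_ofReal ?_
      nlinarith [hf v, h2 v hv]
    rw [prob_compl_eq_one_sub hE, prob_compl_eq_one_sub hE] at h
    exact (ENNReal.sub_le_sub_iff_left prob_le_one ENNReal.one_ne_top).1 h

/-- Otherwise ℓ ≤ 0 almost surely. Since exp ℓ integrates to 1, this forces ℓ = 0 almost surely,
contrary to `h0`. -/
lemma exists_pos_law_llr_ne_zero [IsProbabilityMeasure (law ref f₀)]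
    [IsProbabilityMeasure (law ref f₁)] (hℓ : Measurable (llr f₁ f₀))
    (hlaw : law ref f₁ = (law ref f₀).withDensity fun v => ENNReal.ofReal (Real.exp (llr f₁ f₀ v)))
    (h0 : law ref f₀ {v | llr f₁ f₀ v = 0} = 0) :
    ∃ ε, 0 < ε ∧ law ref f₀ {v | ε ≤ llr f₁ f₀ v} ≠ 0 := by
  by_contra! h
  have hle : ∀ᵐ v ∂law ref f₀, llr f₁ f₀ v ≤ 0 := by
    have hn : ∀ n : ℕ, ∀ᵐ v ∂law ref f₀, ¬ 1 / ((n : ℝ) + 1) ≤ llr f₁ f₀ v := fun n =>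
      compl_mem_ae_iff.2 (h _ Nat.one_div_pos_of_nat)
    filter_upwards [ae_all_iff.2 hn] with v hv
    by_contra! hpos
    obtain ⟨n, hn⟩ := exists_nat_one_div_lt hpos
    exact hv n hn.le
  have hexp : Measurable fun v => ENNReal.ofReal (Real.exp (llr f₁ f₀ v)) := by fun_prop
  have hint : ∫⁻ v, ENNReal.ofReal (Real.exp (llr f₁ f₀ v)) ∂law ref f₀ = 1 := by
    have := measure_univ (μ := law ref f₁)
    rwa [hlaw, withDensity_apply _ MeasurableSet.univ, Measure.restrict_univ] at this
  have hae := ae_eq_of_ae_le_of_lintegral_le (μ := law ref f₀)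
    (f := fun v => ENNReal.ofReal (Real.exp (llr f₁ f₀ v))) (g := fun _ => 1)
    (hle.mono fun v hv => ENNReal.ofReal_le_one.2 (Real.exp_le_one_iff.2 hv))
    (by rw [hint]; exact ENNReal.one_ne_top) measurable_const.aemeasurable (by rw [hint]; simp)
  have h1 : ∀ᵐ v ∂law ref f₀, llr f₁ f₀ v ≠ 0 := compl_mem_ae_iff.2 h0
  have hF : ∀ᵐ v ∂law ref f₀, False := by
    filter_upwards [hae, h1] with v hv hv'
    rw [ENNReal.ofReal_eq_one, Real.exp_eq_one_iff] at hv
    exact hv' hv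
  rw [Filter.eventually_false_iff_eq_bot, ae_eq_bot] at hF
  have := measure_univ (μ := law ref f₀)
  rw [hF] at this
  simp at this

end Optimality

end RobustQCD

/-! ### Monotone likelihood ratio of the maximum magnitude correlation -/

namespace MaxCorrelation

/-- The points at which the densities are positive. -/
def support : Completion → Set ℝ
  | .atomAtZero => Ico 0 1
  | .normalized => Ioo 0 1

variable {n p : ℕ} {κ : Completion}

lemma strictAntiOn_T (hn : 5 ≤ n) : StrictAntiOn (T n) (Icc 0 1) := by
  refine strictAntiOn_of_deriv_neg (convex_Icc 0 1) (continuous_T hn).continuousOn fun v hv => ?_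
  rw [interior_Icc] at hv
  rw [(hasDerivAt_T hn v).deriv, neg_lt_zero]
  exact Real.rpow_pos_of_pos (by nlinarith [hv.1, hv.2]) _

lemma fV_pos (hn : 5 ≤ n) (hp : 2 ≤ p) {J : ℝ} (hJ : 0 < J) {v : ℝ} (hv : v ∈ Ioo (0 : ℝ) 1) :
    0 < fV n p J v := by
  rw [fV, if_pos ⟨hv.1, hv.2.le⟩]
  have hC := C_pos hn hp
  have h2 : 0 < (1 - v ^ 2) ^ (((n : ℝ) - 4) / 2) :=
    Real.rpow_pos_of_pos (by nlinarith [hv.1, hv.2]) _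
  positivity

lemma fV_eq_zero (hn : 5 ≤ n) (J : ℝ) {v : ℝ} (hv : v ∉ Ioo (0 : ℝ) 1) : fV n p J v = 0 := by
  have hn' : (5 : ℝ) ≤ n := by exact_mod_cast hn
  rw [fV]
  split_ifs with h
  · obtain rfl : v = 1 := le_antisymm h.2 (by
      by_contra! h1
      exact hv ⟨h.1, h1⟩)
    -- At `v = 1` the density vanishes because the exponent is positive for `n ≥ 5`.
    have : ((n : ℝ) - 4) / 2 ≠ 0 := by linarith
    simp [Real.zero_rpow this]
  · rfl

lemma density_pos (hn : 5 ≤ n) (hp : 2 ≤ p) {J : ℝ} (hJ : 0 < J) {v : ℝ} (hv : v ∈ support κ) :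
    0 < density κ n p J v := by
  cases κ with
  | atomAtZero =>
    simp only [density]
    split_ifs with h
    · exact Real.exp_pos _
    · exact fV_pos hn hp hJ ⟨lt_of_le_of_ne hv.1 (Ne.symm h), hv.2⟩
  | normalized => exact div_pos (fV_pos hn hp hJ hv) (integral_fV_pos hn hp hJ)

lemma density_eq_zero (hn : 5 ≤ n) (J : ℝ) {v : ℝ} (hv : v ∉ support κ) :
    density κ n p J v = 0 := by
  cases κ with
  | atomAtZero =>
    simp only [density]
    rw [if_neg (by rintro rfl; exact hv ⟨le_rfl, one_pos⟩)]
    exact fV_eq_zero hn J fun h => hv ⟨h.1.le, h.2⟩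
  | normalized =>
    simp only [density]
    rw [fV_eq_zero hn J hv, zero_div]

lemma density_nonneg (hn : 5 ≤ n) (hp : 2 ≤ p) {J : ℝ} (hJ : 0 < J) (v : ℝ) :
    0 ≤ density κ n p J v := by
  by_cases hv : v ∈ support κ
  · exact (density_pos hn hp hJ hv).le
  · exact (density_eq_zero hn J hv).ge

/-- After taking logarithms this is (C / 2) (J₂ - J₁) (T(v) - T(w)) > 0, as T is strictly
decreasing. -/
lemma exp_mul_exp_lt (hn : 5 ≤ n) (hp : 2 ≤ p) {J₁ J₂ : ℝ} (hJ : J₁ < J₂) {v w : ℝ}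
    (hv : v ∈ Icc (0 : ℝ) 1) (hw : w ∈ Icc (0 : ℝ) 1) (hvw : v < w) :
    Real.exp (-(C n p / 2) * J₂ * T n v) * Real.exp (-(C n p / 2) * J₁ * T n w) <
      Real.exp (-(C n p / 2) * J₂ * T n w) * Real.exp (-(C n p / 2) * J₁ * T n v) := by
  rw [← Real.exp_add, ← Real.exp_add, Real.exp_lt_exp]
  have h1 := strictAntiOn_T hn hv hw hvw
  have h2 := mul_pos (half_pos (C_pos hn hp)) (mul_pos (sub_pos.2 hJ) (sub_pos.2 h1))
  nlinarith

/-- The densities have a strictly monotone likelihood ratio. -/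
lemma density_mul_density_lt (hn : 5 ≤ n) (hp : 2 ≤ p) {J₁ J₂ : ℝ} (hJ₁ : 0 < J₁) (hJ : J₁ < J₂)
    {v w : ℝ} (hv : v ∈ support κ) (hw : w ∈ support κ) (hvw : v < w) :
    density κ n p J₂ v * density κ n p J₁ w < density κ n p J₂ w * density κ n p J₁ v := by
  have hJ₂ : 0 < J₂ := hJ₁.trans hJ
  have hC := C_pos hn hp
  have hb : ∀ u ∈ Ioo (0 : ℝ) 1, 0 < C n p / 2 * (1 - u ^ 2) ^ (((n : ℝ) - 4) / 2) := by
    intro u hu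
    have : 0 < (1 - u ^ 2) ^ (((n : ℝ) - 4) / 2) :=
      Real.rpow_pos_of_pos (by nlinarith [hu.1, hu.2]) _
    positivity
  have hf : ∀ u ∈ Ioo (0 : ℝ) 1, ∀ J, fV n p J u =
      C n p / 2 * (1 - u ^ 2) ^ (((n : ℝ) - 4) / 2) * J * Real.exp (-(C n p / 2) * J * T n u) :=
    fun u hu J => if_pos ⟨hu.1, hu.2.le⟩
  have hfV : v ∈ Ioo (0 : ℝ) 1 → w ∈ Ioo (0 : ℝ) 1 →
      fV n p J₂ v * fV n p J₁ w < fV n p J₂ w * fV n p J₁ v := by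
    intro hv hw
    rw [hf v hv, hf w hw, hf w hw, hf v hv]
    have h := mul_lt_mul_of_pos_left (exp_mul_exp_lt hn hp hJ ⟨hv.1.le, hv.2.le⟩
      ⟨hw.1.le, hw.2.le⟩ hvw) (mul_pos (mul_pos (hb v hv) (hb w hw)) (mul_pos hJ₁ hJ₂))
    linarith
  cases κ with
  | atomAtZero =>
    have hw0 : w ∈ Ioo (0 : ℝ) 1 := ⟨lt_of_le_of_lt hv.1 hvw, hw.2⟩
    simp only [density, if_neg hw0.1.ne']
    split_ifs with h
    · subst h
      rw [hf w hw0, hf w hw0]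
      have h1 := exp_mul_exp_lt hn hp hJ ⟨hv.1, hv.2.le⟩ ⟨hw0.1.le, hw0.2.le⟩ hvw
      have h2 := mul_lt_mul_of_pos_left h1 (mul_pos (hb w hw0) hJ₁)
      -- Passing from the atom to the continuous part brings in the extra factor J₂ / J₁ > 1, which
      -- has the right direction.
      have h3 := mul_lt_mul_of_pos_left hJ (mul_pos (hb w hw0) (mul_pos
        (Real.exp_pos (-(C n p / 2) * J₂ * T n w)) (Real.exp_pos (-(C n p / 2) * J₁ * T n 0))))
      linarith
    · exact hfV ⟨lt_of_le_of_ne hv.1 (Ne.symm h), hv.2⟩ hw0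
  | normalized =>
    simp only [density]
    rw [div_mul_div_comm, div_mul_div_comm]
    exact div_lt_div_of_pos_right (hfV hv hw)
      (mul_pos (integral_fV_pos hn hp hJ₂) (integral_fV_pos hn hp hJ₁))

lemma measurable_llr (hn : 5 ≤ n) (J₁ J₀ : ℝ) :
    Measurable (llr (density κ n p J₁) (density κ n p J₀)) :=
  Real.measurable_log.comp ((measurable_density κ p hn J₁).div (measurable_density κ p hn J₀))

lemma strictMonoOn_llr (hn : 5 ≤ n) (hp : 2 ≤ p) {J₁ J₂ : ℝ} (hJ₁ : 0 < J₁) (hJ : J₁ < J₂) :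
    StrictMonoOn (llr (density κ n p J₂) (density κ n p J₁)) (support κ) := by
  intro v hv w hw hvw
  have hJ₂ : 0 < J₂ := hJ₁.trans hJ
  refine Real.log_lt_log (div_pos (density_pos hn hp hJ₂ hv) (density_pos hn hp hJ₁ hv)) ?_
  rw [div_lt_div_iff₀ (density_pos hn hp hJ₁ hv) (density_pos hn hp hJ₁ hw)]
  exact density_mul_density_lt hn hp hJ₁ hJ hv hw hvw

lemma law_density_eq_withDensity (hn : 5 ≤ n) (hp : 2 ≤ p) {J₁ J₂ : ℝ} (hJ₁ : 0 < J₁)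
    (hJ₂ : 0 < J₂) :
    law (refMeasure κ) (density κ n p J₂) = (law (refMeasure κ) (density κ n p J₁)).withDensity
      fun v => ENNReal.ofReal (Real.exp (llr (density κ n p J₂) (density κ n p J₁) v)) := by
  have hm := measurable_llr (κ := κ) (p := p) hn J₂ J₁
  rw [law, law, ← withDensity_mul _ (measurable_density κ p hn J₁).ennreal_ofReal
    hm.exp.ennreal_ofReal]
  congr 1
  funext v
  rw [Pi.mul_apply, ← ENNReal.ofReal_mul (density_nonneg hn hp hJ₁ v)]
  by_cases hv : v ∈ support κ
  · have h1 := density_pos hn hp hJ₁ hv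
    have h2 := density_pos hn hp hJ₂ hv
    rw [RobustQCD.llr, Real.exp_log (div_pos h2 h1), mul_div_cancel₀ _ h1.ne']
  -- Off the support the logarithm of 0 / 0 is a default value, harmless because both densities
  -- vanish there.
  · rw [density_eq_zero hn J₂ hv, density_eq_zero hn J₁ hv, zero_mul]

lemma law_density_eq_zero (hn : 5 ≤ n) (J : ℝ) {S : Set ℝ} (hS : MeasurableSet S)
    (hd : ∀ v ∈ S, v ∉ support κ) : law (refMeasure κ) (density κ n p J) S = 0 := by
  rw [law, withDensity_apply _ hS, setLIntegral_congr_fun hS (g := fun _ => 0)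
    fun v hv => by simp [density_eq_zero hn J (hd v hv)]]
  simp

lemma measurableSet_support : MeasurableSet (support κ) := by
  cases κ
  · exact measurableSet_Ico
  · exact measurableSet_Ioo

/-- The log-likelihood ratio has at most one atom, which is negative. -/
lemma law_llr_eq_zero (hn : 5 ≤ n) (hp : 2 ≤ p) {Jbar : ℝ} (hJ : 1 < Jbar) :
    ∃ r₀ < 0, ∀ r, r ≠ r₀ → law (refMeasure κ) (density κ n p 1)
      {v | llr (density κ n p Jbar) (density κ n p 1) v = r} = 0 := by
  set ℓ := llr (density κ n p Jbar) (density κ n p 1) with hℓ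
  have hm : Measurable ℓ := measurable_llr hn _ _
  have hmono : StrictMonoOn ℓ (support κ) := strictMonoOn_llr hn hp one_pos hJ
  have hmr : ∀ r, MeasurableSet {v | ℓ v = r} := fun r => hm (measurableSet_singleton r)
  have key : ∀ r, refMeasure κ ({v | ℓ v = r} ∩ support κ) = 0 →
      law (refMeasure κ) (density κ n p 1) {v | ℓ v = r} = 0 := by
    intro r hr
    rw [← measure_inter_add_sdiff {v | ℓ v = r} (measurableSet_support (κ := κ)),
      law_density_eq_zero hn 1 ((hmr r).diff measurableSet_support)
        (fun v hv => hv.2), add_zero]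
    exact withDensity_absolutelyContinuous _ _ hr
  -- ℓ is injective on the support, so only a point charged by the reference measure can produce an
  -- atom: the point 0 in the first completion.
  have hsub : ∀ r, ({v | ℓ v = r} ∩ support κ).Subsingleton := by
    rintro r v ⟨hv, hv'⟩ w ⟨hw, hw'⟩
    exact hmono.injOn hv' hw' ((show ℓ v = r from hv).trans (show ℓ w = r from hw).symm)
  cases κ with
  | atomAtZero =>
    have h0 : (0 : ℝ) ∈ support .atomAtZero := ⟨le_rfl, one_pos⟩
    refine ⟨ℓ 0, ?_, fun r hr => key r ?_⟩
    · have h1 := C_pos hn hp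
      have h2 := T_zero_pos hn
      rw [hℓ, RobustQCD.llr, Real.log_neg_iff (div_pos (density_pos hn hp (by linarith) h0)
        (density_pos hn hp one_pos h0)), div_lt_one (density_pos hn hp one_pos h0)]
      simp only [density, if_true]
      rw [Real.exp_lt_exp]
      have := mul_pos (mul_pos (half_pos h1) (sub_pos.2 hJ)) h2
      nlinarith
    · simp only [refMeasure, Measure.add_apply, add_eq_zero]
      refine ⟨(hsub r).measure_zero _, ?_⟩
      rw [Measure.dirac_apply' _ ((hmr r).inter measurableSet_support)]
      exact indicator_of_notMem (fun h => hr (show ℓ 0 = r from h.1).symm) _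
  -- There is no atom in this case; -1 is an arbitrary negative number.
  | normalized => exact ⟨-1, by norm_num, fun r _ => key r (by
      simp only [refMeasure]
      exact (hsub r).measure_zero _)⟩

/-- The family of laws with a parameter `J ≥ Jbar` is stochastically bounded from below by the law
with the parameter `Jbar`. -/
lemma stochLarger_density (hn : 5 ≤ n) (hp : 2 ≤ p) {Jbar J : ℝ} (hJbar : 1 < Jbar)
    (hJ : Jbar ≤ J) :
    StochLarger
      ((law (refMeasure κ) (density κ n p J)).map (llr (density κ n p Jbar) (density κ n p 1)))
      ((law (refMeasure κ) (density κ n p Jbar)).map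
        (llr (density κ n p Jbar) (density κ n p 1))) := by
  rcases hJ.eq_or_lt with rfl | hJ
  · exact fun t => le_rfl
  intro t
  have hJ0 : 0 < Jbar := by linarith
  have hJ1 : 0 < J := by linarith
  have := isProbabilityMeasure_law κ hn hp hJ0
  have := isProbabilityMeasure_law κ hn hp hJ1
  set ℓ := llr (density κ n p Jbar) (density κ n p 1)
  have hm : Measurable ℓ := measurable_llr hn _ _
  have hmono : StrictMonoOn ℓ (support κ) := strictMonoOn_llr hn hp one_pos hJbar
  rw [Measure.map_apply hm measurableSet_Ici, Measure.map_apply hm measurableSet_Ici]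
  set E := ℓ ⁻¹' Ici t
  have hE : MeasurableSet E := hm measurableSet_Ici
  rcases (E ∩ support κ).eq_empty_or_nonempty with hempty | hne
  · rw [law_density_eq_zero hn Jbar hE fun v hv hv' => (hempty.subset ⟨hv, hv'⟩).elim]
    exact zero_le
  set R : ℝ → ℝ := fun v => density κ n p J v / density κ n p Jbar v
  have hbdd : BddBelow (R '' (E ∩ support κ)) := ⟨0, by
    rintro _ ⟨v, -, rfl⟩
    exact div_nonneg (density_nonneg hn hp hJ1 v) (density_nonneg hn hp hJ0 v)⟩
  -- The event `E` is an upper part of the support, because ℓ is increasing there. The ratio `R` is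
  -- increasing too, so its infimum over `E` separates its values on and off `E`.
  refine law_le_law_of_le (density_nonneg hn hp hJ0) hE (c := sInf (R '' (E ∩ support κ)))
    (fun v hv => ?_) (fun v hv => ?_)
  · by_cases hs : v ∈ support κ
    · have := csInf_le hbdd (mem_image_of_mem R ⟨hv, hs⟩)
      rwa [le_div_iff₀ (density_pos hn hp hJ0 hs)] at this
    · rw [density_eq_zero hn J hs, density_eq_zero hn Jbar hs, mul_zero]
  · by_cases hs : v ∈ support κ
    · rw [← div_le_iff₀ (density_pos hn hp hJ0 hs)]
      refine le_csInf (hne.image R) ?_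
      rintro _ ⟨w, ⟨hw, hw'⟩, rfl⟩
      have hvw : v < w := (hmono.lt_iff_lt hs hw').1
        (lt_of_lt_of_le (not_le.1 (show ¬ t ≤ ℓ v from hv)) hw)
      simp only [R]
      rw [div_le_div_iff₀ (density_pos hn hp hJ0 hs) (density_pos hn hp hJ0 hw')]
      exact (density_mul_density_lt hn hp hJ0 hJ hs hw' hvw).le
    · rw [density_eq_zero hn J hs, density_eq_zero hn Jbar hs, mul_zero]

end MaxCorrelation

theorem mainTheorem1 (κ : Completion) (n p : ℕ) (hn : 5 ≤ n) (hp : 2 ≤ p)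
    (Jbar : ℝ) (hJbar : 1 < Jbar) :
    -- the density with parameter `Jbar` is the least favorable law
    IsLFL (refMeasure κ) (density κ n p 1) (uncertaintyClass κ n p Jbar)
      (fun _ _ => density κ n p Jbar) ∧
    -- robust optimality of the CUSUM test, whether or not the post-change parameters may also
    -- depend on the change point
    ∀ 𝒢 : Set (ℕ → ℕ → ℝ → ℝ),
      (𝒢 = timeVaryingSequences κ n p Jbar ∨ 𝒢 = sequencesIn (uncertaintyClass κ n p Jbar)) →
      -- every CUSUM test that meets the false alarm constraint with equality is optimal
      (∀ β A : ℝ, 0 < β →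
        MFA (refMeasure κ) (density κ n p 1)
          (cusumTime (density κ n p Jbar) (density κ n p 1) A) = ENNReal.ofReal β →
        IsRobustOptimal (refMeasure κ) (density κ n p 1) 𝒢 β
          (cusumTime (density κ n p Jbar) (density κ n p 1) A)) ∧
      -- such a threshold exists for every large `β`; for `β ≤ 1` a test with `MFA = 1` is optimal
      (∀ β : ℝ, 0 < β →
        (β ≤ 1 ∨ 1 < β * (law (refMeasure κ) (density κ n p 1)).real
          {v | 0 < llr (density κ n p Jbar) (density κ n p 1) v}) →
        ∃ A : ℝ,
          MFA (refMeasure κ) (density κ n p 1)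
            (cusumTime (density κ n p Jbar) (density κ n p 1) A) = ENNReal.ofReal (max 1 β) ∧
          IsRobustOptimal (refMeasure κ) (density κ n p 1) 𝒢 β
            (cusumTime (density κ n p Jbar) (density κ n p 1) A)) := by
  have hJ0 : 0 < Jbar := by linarith
  have := isProbabilityMeasure_law κ hn hp one_pos
  have := isProbabilityMeasure_law κ hn hp hJ0
  have hℓ : Measurable (llr (density κ n p Jbar) (density κ n p 1)) := measurable_llr hn _ _
  refine ⟨⟨fun _ _ _ _ => ⟨Jbar, le_rfl, rfl⟩, ?_⟩, fun 𝒢 h𝒢 => ?_⟩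
  · rintro m ν - - _ ⟨J, hJ, rfl⟩
    exact stochLarger_density hn hp hJbar hJ
  have hlaw := law_density_eq_withDensity (κ := κ) hn hp one_pos hJ0
  obtain ⟨r₀, hr₀, hat⟩ := law_llr_eq_zero (κ := κ) hn hp hJbar
  -- The only possible atom of ℓ is negative, so ℓ has none at 0.
  obtain ⟨ε, hε, hμ⟩ := exists_pos_law_llr_ne_zero hℓ hlaw (hat 0 hr₀.ne')
  have hmem : (fun _ _ => density κ n p Jbar) ∈ 𝒢 := by
    rcases h𝒢 with rfl | rfl
    · exact ⟨fun _ => Jbar, fun _ _ => le_rfl, rfl⟩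
    · exact fun _ _ _ _ => ⟨Jbar, le_rfl, rfl⟩
  have hclass : ∀ G ∈ 𝒢, ∀ m ν, 1 ≤ m → 1 ≤ ν → ∃ J, Jbar ≤ J ∧ G m ν = density κ n p J := by
    rcases h𝒢 with rfl | rfl
    · rintro _ ⟨J, hJ, rfl⟩ m ν hm _
      exact ⟨J m, hJ m hm, rfl⟩
    · exact fun G hG => hG
  have hpr : ∀ G ∈ 𝒢, ∀ m ν, 1 ≤ m → 1 ≤ ν →
      IsProbabilityMeasure (law (refMeasure κ) (G m ν)) := by
    intro G hG m ν hm hν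
    obtain ⟨J, hJ, hGJ⟩ := hclass G hG m ν hm hν
    rw [hGJ]
    exact isProbabilityMeasure_law κ hn hp (hJ0.trans_le hJ)
  have hst : ∀ G ∈ 𝒢, ∀ m ν, 1 ≤ m → 1 ≤ ν →
      StochLarger ((law (refMeasure κ) (G m ν)).map (llr (density κ n p Jbar) (density κ n p 1)))
        ((law (refMeasure κ) (density κ n p Jbar)).map
          (llr (density κ n p Jbar) (density κ n p 1))) := by
    intro G hG m ν hm hν
    obtain ⟨J, hJ, hGJ⟩ := hclass G hG m ν hm hν
    rw [hGJ]
    exact stochLarger_density hn hp hJbar hJ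
  refine ⟨fun β A _ hA => ?_, fun β _ hβ => ?_⟩
  · rcases le_or_gt A 0 with h | h
    · refine isRobustOptimal_cusumTime_of_nonpos hℓ hmem hpr h ?_
      -- A nonpositive threshold has false alarm time 1, hence `β = 1`.
      rw [MFA_cusumTime_of_nonpos h] at hA
      exact (ENNReal.ofReal_eq_one.1 hA.symm).le
    · exact isRobustOptimal_cusumTime_of_pos hℓ hlaw hε hμ hmem hpr hst h hA
  · rcases le_or_gt β 1 with h | h
    · refine ⟨0, ?_, isRobustOptimal_cusumTime_of_nonpos hℓ hmem hpr le_rfl h⟩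
      rw [MFA_cusumTime_of_nonpos le_rfl, max_eq_left h, ENNReal.ofReal_one]
    · rw [max_eq_right h.le]
      obtain ⟨A, hA, hMFA⟩ := exists_MFA_cusumTime_eq hℓ hr₀.le hat hε hμ
        (hβ.resolve_left (not_le.2 h))
      exact ⟨A, hMFA, isRobustOptimal_cusumTime_of_pos hℓ hlaw hε hμ hmem hpr hst hA hMFA⟩
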